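/- Let $H\in(0,1)$, $T>0$. Let $\mathfrak H$ be the Hilbert space obtained by completing the step functions on $[0,T]$ under $\langle 1_{[0,t]},1_{[0,s]}\rangle_{\mathfrak H}=\frac12(t^{2H}+s^{2H}-|t-s|^{2H})$, let $\mathbb W=(\mathbb W(h))_{h\in\mathfrak H}$ be an isonormal Gaussian process on a probability space $(\Omega,\mathcal F,P)$, and let $B_t=\mathbb W(1_{[0,t]})$, a fractional Brownian motion with Hurst coefficient $H$. Let $I_2$ denote the double Wiener integral ($I_2(h^{\otimes2})=\mathbb W(h)^2-\|h\|_{\mathfrak H}^2$). For $t^n_j=jT/n$ put $1^n_j=1_{(t^n_{j-1},t^n_j]}$, $$V_n=\sum_{j=1}^{n-1}(B_{t^n_{j+1}}-2B_{t^n_j}+B_{t^n_{j-1}})^2,\qquad M_n=-\sqrt n\Big\{\Big[\tfrac{V_{2n}}{E[V_{2n}]}-1\Big]-\Big[\tfrac{V_n}{E[V_n]}-1\Big]\Big\},$$ $$f^{[\alpha]}_n=\frac{\sqrt n\sum_{j=1}^{\alpha n-1}(1^{\alpha n}_{j+1}-1^{\alpha n}_j)^{\otimes2}}{E[V_{\alpha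 n}]}\ (\alpha=1,2),\qquad \widetilde G_n=2I_2(f^{[2]}_n\otimes_1f^{[2]}_n)-4I_2(f^{[2]}_n\odot_1f^{[1]}_n)+2I_2(f^{[1]}_n\otimes_1f^{[1]}_n),$$ where $\otimes_1$ is the contraction of order one and $\odot_1$ its symmetrization. For $j\in\mathbb Z$ let $$\widehat\rho(j)=\tfrac12\{-|j-2|^{2H}+4|j-1|^{2H}-6|j|^{2H}+4|j+1|^{2H}-|j+2|^{2H}\},$$ $$\widetilde\rho(j)=2^{-2H-1}\{-|j-3|^{2H}+2|j-2|^{2H}+|j-1|^{2H}-4|j|^{2H}+|j+1|^{2H}+2|j+2|^{2H}-|j+3|^{2H}\},$$ and, with $c=4-2^{2H}$, $$\Sigma_{11}=2\Big[1+\tfrac2{c^2}\sum_{i\ge1}\widehat\rho(i)^2\Big],\quad \Sigma_{22}=\tfrac12\Sigma_{11},\quad \Sigma_{12}=\tfrac{2^{2H}}{c^2}\sum_{\ell\in\mathbb Z}\widetilde\rho(\ell)^2,\quad G_\infty=\Sigma_{22}-2\Sigma_{12}+\Sigma_{11}.$$ With all sums over $\mathbb Z$, let $$\kappa(1;1,1)=c^{-3}\sum_{i_1,i_2}\widehat\rho(i_1)\widehat\rho(i_1-i_2)\widehat\rho(i_2),\qquad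 \kappa(2;2,2)=\tfrac14\kappa(1;1,1),$$ $$\kappa(2;1,1)=\kappa(1;1,2)=2^{2H-1}c^{-3}\sum_{i_1,i_2}\widehat\rho(i_1)\widetilde\rho(i_2-2i_1)\widetilde\rho(i_2),$$ $$\kappa(1;2,2)=\kappa(2;1,2)=2^{2H-2}c^{-3}\sum_{i_1,i_2}\widehat\rho(i_1)\widetilde\rho(i_1-i_2)\widetilde\rho(i_2),$$ $$\kappa(1,1;1,1)=c^{-4}\sum_{i_1,i_2,i_3}\widehat\rho(i_1)\widehat\rho(i_1-i_2)\widehat\rho(i_2-i_3)\widehat\rho(i_3),\qquad \kappa(2,2;2,2)=\tfrac18\kappa(1,1;1,1),$$ $$\kappa(1,1;2,2)=2^{2H-2}c^{-4}\sum_{i_1,i_2,i_3}\{\widetilde\rho(2i_1)\widehat\rho(i_1-i_2)\widetilde\rho(2i_2-i_3)\widehat\rho(i_3)+\widetilde\rho(2i_1+1)\widehat\rho(i_1-i_2)\widetilde\rho(2i_2-i_3+1)\widehat\rho(i_3)\},$$ $$\kappa(1,1;1,2)=2^{2H-1}c^{-4}\sum_{i_1,i_2,i_3}\widehat\rho(i_1)\widetilde\rho(2i_1-i_2)\widetilde\rho(i_2-2i_3)\widehat\rho(i_3),$$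 $$\kappa(1,2;2,2)=2^{2H-3}c^{-4}\sum_{i_1,i_2,i_3}\widehat\rho(i_1)\widehat\rho(i_1-i_2)\widetilde\rho(i_2-i_3)\widetilde\rho(i_3),$$ $$\kappa(1,2;1,2)=2^{2H-3}c^{-4}\sum_{i_1,i_2,i_3}\widehat\rho(i_1)\widetilde\rho(2i_1-i_2)\widehat\rho(i_2-i_3)\widetilde\rho(i_3)$$ $$\qquad+2^{4H-3}c^{-4}\Big\{\sum_{i_1,i_2,i_3}\widetilde\rho(2i_1)\widetilde\rho(2i_1-i_2)\widetilde\rho(i_2-2i_3)\widetilde\rho(2i_3)+\sum_{i_1,i_2,i_3}\widetilde\rho(2i_1+1)\widetilde\rho(2i_1-i_2)\widetilde\rho(i_2-2i_3)\widetilde\rho(2i_3+1)\Big\}.$$ Let $\mathfrak U$ be the symmetric $3\times3$ matrix with $\mathfrak U_{11}=\Sigma_{11}$, $\mathfrak U_{12}=\Sigma_{12}$, $\mathfrak U_{22}=\Sigma_{22}$, $$\mathfrak U_{13}=4\kappa(1;2,2)-8\kappa(1;1,2)+4\kappa(1;1,1),\qquad \mathfrak U_{23}=4\kappa(2;2,2)-8\kappa(2;1,2)+4\kappa(2;1,1),$$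 $$\mathfrak U_{33}=8\kappa(2,2;2,2)+32\kappa(1,2;1,2)+8\kappa(1,1;1,1)-32\kappa(1,2;2,2)+16\kappa(1,1;2,2)-32\kappa(1,1;1,2),$$ and let $\mathfrak T$ be the symmetric $2\times2$ matrix with $\mathfrak T_{11}=\mathfrak U_{11}-2\mathfrak U_{12}+\mathfrak U_{22}$, $\mathfrak T_{12}=\mathfrak U_{13}-\mathfrak U_{23}$, $\mathfrak T_{22}=\mathfrak U_{33}$. Then all these series converge absolutely, $\mathfrak T$ is positive semidefinite, and $T_n=(M_n,n^{1/2}\widetilde G_n)$ converges in distribution to the centered normal law $N_2(0,\mathfrak T)$ as $n\to\infty$. Moreover $$G_\infty=\mathfrak T_{11}=\Sigma_{22}-2\Sigma_{12}+\Sigma_{11}=\tfrac32\Sigma_{11}-2\Sigma_{12}\ge\big(\tfrac32-\sqrt2\big)\Sigma_{11}>0.$$ -/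

import Mathlib

open MeasureTheory ProbabilityTheory Filter
open scoped TensorProduct InnerProductSpace

namespace FracBM

noncomputable section

/-- The covariance function of fractional Brownian motion with Hurst coefficient `H`. -/
def covKernel (H s t : ℝ) : ℝ :=
  (t ^ (2 * H) + s ^ (2 * H) - |t - s| ^ (2 * H)) / 2

theorem covKernel_symm (H s t : ℝ) : covKernel H s t = covKernel H t s := by
  rw [covKernel, covKernel, abs_sub_comm]; ring

theorem integrableOn_one_sub_cos {H : ℝ} (h0 : 0 < H) (h1 : H < 1) (t : ℝ) :
    IntegrableOn (fun x : ℝ => (1 - Real.cos (t * x)) * x ^ (-1 - 2 * H)) (Set.Ioi 0) := by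
  have hmeas : AEStronglyMeasurable
      (fun x : ℝ => (1 - Real.cos (t * x)) * x ^ (-1 - 2 * H)) := by
    apply Measurable.aestronglyMeasurable
    fun_prop
  rw [← Set.Ioc_union_Ioi_eq_Ioi (zero_le_one' ℝ)]
  refine IntegrableOn.union ?_ ?_
  · have hi : IntegrableOn (fun x : ℝ => t ^ 2 / 2 * x ^ (1 - 2 * H)) (Set.Ioc 0 1) := by
      refine Integrable.const_mul ?_ _
      have := intervalIntegral.intervalIntegrable_rpow' (a := 0) (b := 1) (r := 1 - 2 * H)
        (by linarith)
      rwa [intervalIntegrable_iff_integrableOn_Ioc_of_le zero_le_one] at this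
    refine Integrable.mono' hi hmeas.restrict ?_
    refine (ae_restrict_iff' measurableSet_Ioc).2 (Eventually.of_forall fun x hx => ?_)
    have hx0 : 0 < x := hx.1
    have hc : 0 ≤ 1 - Real.cos (t * x) := by linarith [Real.cos_le_one (t * x)]
    rw [Real.norm_of_nonneg (mul_nonneg hc (Real.rpow_nonneg hx0.le _))]
    have e : x ^ (1 - 2 * H) = x ^ 2 * x ^ (-1 - 2 * H) := by
      rw [← Real.rpow_natCast, ← Real.rpow_add hx0]; congr 1; push_cast; ring
    rw [e, ← mul_assoc]
    refine mul_le_mul_of_nonneg_right ?_ (Real.rpow_nonneg hx0.le _)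
    have := Real.one_sub_sq_div_two_le_cos (x := t * x)
    nlinarith
  · have hi : IntegrableOn (fun x : ℝ => 2 * x ^ (-1 - 2 * H)) (Set.Ioi 1) :=
      (integrableOn_Ioi_rpow_of_lt (by linarith) one_pos).const_mul 2
    refine Integrable.mono' hi hmeas.restrict ?_
    refine (ae_restrict_iff' measurableSet_Ioi).2 (Eventually.of_forall fun x hx => ?_)
    have hx0 : 0 < x := lt_trans one_pos hx
    have hc : 0 ≤ 1 - Real.cos (t * x) := by linarith [Real.cos_le_one (t * x)]
    rw [Real.norm_of_nonneg (mul_nonneg hc (Real.rpow_nonneg hx0.le _))]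
    exact mul_le_mul_of_nonneg_right (by linarith [Real.neg_one_le_cos (t * x)])
      (Real.rpow_nonneg hx0.le _)

theorem integral_one_sub_cos {H : ℝ} (h0 : 0 < H) (t : ℝ) :
    ∫ x in Set.Ioi (0 : ℝ), (1 - Real.cos (t * x)) * x ^ (-1 - 2 * H) =
      |t| ^ (2 * H) * ∫ x in Set.Ioi (0 : ℝ), (1 - Real.cos (1 * x)) * x ^ (-1 - 2 * H) := by
  rcases eq_or_ne t 0 with rfl | ht
  · simp [Real.zero_rpow (by positivity : 2 * H ≠ 0)]
  have ht' : 0 < |t| := abs_pos.2 ht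
  have key := integral_comp_mul_left_Ioi
    (fun x : ℝ => (1 - Real.cos (1 * x)) * x ^ (-1 - 2 * H)) 0 ht'
  rw [mul_zero] at key
  have e : ∀ x ∈ Set.Ioi (0 : ℝ), (1 - Real.cos (t * x)) * x ^ (-1 - 2 * H) =
      |t| ^ (1 + 2 * H) * ((1 - Real.cos (1 * (|t| * x))) * (|t| * x) ^ (-1 - 2 * H)) := by
    intro x hx
    have hx0 : (0 : ℝ) < x := hx
    have hcos : Real.cos (1 * (|t| * x)) = Real.cos (t * x) := by
      rw [one_mul, ← Real.cos_abs (t * x), abs_mul, abs_of_pos hx0]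
    rw [hcos, Real.mul_rpow ht'.le hx0.le]
    have : |t| ^ (1 + 2 * H) * |t| ^ (-1 - 2 * H) = 1 := by
      rw [← Real.rpow_add ht']; ring_nf; simp
    linear_combination (-(1 - Real.cos (t * x)) * x ^ (-1 - 2 * H)) * this
  rw [setIntegral_congr_fun measurableSet_Ioi e, integral_const_mul, key, smul_eq_mul, ← mul_assoc]
  congr 1
  rw [Real.rpow_add ht', Real.rpow_one]
  field_simp

theorem integral_one_sub_cos_pos {H : ℝ} (h0 : 0 < H) (h1 : H < 1) :
    0 < ∫ x in Set.Ioi (0 : ℝ), (1 - Real.cos (1 * x)) * x ^ (-1 - 2 * H) := by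
  rw [setIntegral_pos_iff_support_of_nonneg_ae _ (integrableOn_one_sub_cos h0 h1 1)]
  · refine lt_of_lt_of_le ?_ (measure_mono (s := Set.Ioo (0 : ℝ) 1) ?_)
    · simp
    · intro x hx
      refine ⟨?_, hx.1⟩
      have hlt : Real.cos (1 * x) < 1 := by
        rw [one_mul, ← Real.cos_zero]
        exact Real.cos_lt_cos_of_nonneg_of_le_pi le_rfl
          (by linarith [hx.2, Real.pi_gt_three]) hx.1
      exact mul_ne_zero (by linarith) (Real.rpow_pos_of_pos hx.1 _).ne'
  · refine (ae_restrict_iff' measurableSet_Ioi).2 (Eventually.of_forall fun x hx => ?_)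
    exact mul_nonneg (by linarith [Real.cos_le_one (1 * x)]) (Real.rpow_nonneg (le_of_lt hx) _)

theorem covKernel_nonneg {H : ℝ} (h0 : 0 < H) (h1 : H < 1) {ι : Type*} (S : Finset ι)
    (τ : ι → ℝ) (hτ : ∀ i, 0 ≤ τ i) (a : ι → ℝ) :
    0 ≤ ∑ i ∈ S, ∑ j ∈ S, a i * a j * covKernel H (τ i) (τ j) := by
  set C := ∫ x in Set.Ioi (0 : ℝ), (1 - Real.cos (1 * x)) * x ^ (-1 - 2 * H) with hC
  have hCpos : 0 < C := integral_one_sub_cos_pos h0 h1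
  let g : ℝ → ℝ → ℝ := fun t x => (1 - Real.cos (t * x)) * x ^ (-1 - 2 * H)
  have hg : ∀ t, IntegrableOn (g t) (Set.Ioi 0) := integrableOn_one_sub_cos h0 h1
  have hgi : ∀ t, ∫ x in Set.Ioi (0 : ℝ), g t x = |t| ^ (2 * H) * C := integral_one_sub_cos h0
  have e : 2 * C * ∑ i ∈ S, ∑ j ∈ S, a i * a j * covKernel H (τ i) (τ j) =
      ∫ x in Set.Ioi (0 : ℝ), ∑ i ∈ S, ∑ j ∈ S,
        a i * a j * (g (τ j) x + g (τ i) x - g (τ j - τ i) x) := by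
    have hij : ∀ i j, IntegrableOn
        (fun x => a i * a j * (g (τ j) x + g (τ i) x - g (τ j - τ i) x)) (Set.Ioi 0) :=
      fun i j => (((hg _).add (hg _)).sub (hg _)).const_mul _
    rw [integral_finsetSum _ fun i _ => integrable_finsetSum _ fun j _ => hij i j, Finset.mul_sum]
    refine Finset.sum_congr rfl fun i _ => ?_
    rw [integral_finsetSum _ fun j _ => hij i j, Finset.mul_sum]
    refine Finset.sum_congr rfl fun j _ => ?_
    have hadd : IntegrableOn (fun x => g (τ j) x + g (τ i) x) (Set.Ioi 0) := (hg _).add (hg _)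
    rw [integral_const_mul, integral_sub hadd (hg _), integral_add (hg _) (hg _), hgi, hgi, hgi, abs_of_nonneg (hτ i), abs_of_nonneg (hτ j),
      covKernel]
    ring
  have e2 : 0 ≤ 2 * C * ∑ i ∈ S, ∑ j ∈ S, a i * a j * covKernel H (τ i) (τ j) := by
    rw [e]
    refine setIntegral_nonneg measurableSet_Ioi fun x hx => ?_
    have : ∑ i ∈ S, ∑ j ∈ S, a i * a j * (g (τ j) x + g (τ i) x - g (τ j - τ i) x) =
        ((∑ i ∈ S, a i * (1 - Real.cos (τ i * x))) ^ 2 + (∑ i ∈ S, a i * Real.sin (τ i * x)) ^ 2) *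
          x ^ (-1 - 2 * H) := by
      rw [sq, sq, Finset.sum_mul_sum, Finset.sum_mul_sum, ← Finset.sum_add_distrib,
        Finset.sum_mul]
      refine Finset.sum_congr rfl fun i _ => ?_
      rw [← Finset.sum_add_distrib, Finset.sum_mul]
      refine Finset.sum_congr rfl fun j _ => ?_
      simp only [g, sub_mul (τ j), Real.cos_sub]
      ring
    rw [this]
    exact mul_nonneg (by positivity) (Real.rpow_nonneg (le_of_lt hx) _)
  exact nonneg_of_mul_nonneg_right e2 (by positivity)


/-- The space of step functions on `[0, T]`. The functions `1_{[0,t]}`, `t ∈ [0, T]`, are linearly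
independent, so their span is presented here through this basis: `Finsupp.single t 1` is
`1_{[0,t]}`. It carries the inner product `⟨1_{[0,t]}, 1_{[0,s]}⟩ = covKernel H s t`. -/
def StepFn (_H : Set.Ioo (0 : ℝ) 1) (T : ℝ) : Type := Set.Icc (0 : ℝ) T →₀ ℝ

namespace StepFn

variable (H : Set.Ioo (0 : ℝ) 1) (T : ℝ)

instance : AddCommGroup (StepFn H T) := inferInstanceAs (AddCommGroup (Set.Icc (0 : ℝ) T →₀ ℝ))

instance : Module ℝ (StepFn H T) := inferInstanceAs (Module ℝ (Set.Icc (0 : ℝ) T →₀ ℝ))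

/-- The bilinear extension of `covKernel` to step functions. -/
def innerStep (f g : Set.Icc (0 : ℝ) T →₀ ℝ) : ℝ :=
  f.sum fun s a => g.sum fun t b => a * b * covKernel H s t

/-- The semi-inner product on step functions. -/
@[reducible] def core : PreInnerProductSpace.Core ℝ (StepFn H T) where
  inner f g := innerStep H T f g
  conj_inner_symm f g := by
    simp only [innerStep, conj_trivial, Finsupp.sum]
    rw [Finset.sum_comm]
    refine Finset.sum_congr rfl fun s _ => Finset.sum_congr rfl fun t _ => ?_
    rw [covKernel_symm]
    ring
  re_inner_nonneg f := by
    have := covKernel_nonneg H.2.1 H.2.2 (Finsupp.support f) (fun i => (i : ℝ))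
      (fun i => i.2.1) (fun i => (show Set.Icc (0 : ℝ) T →₀ ℝ from f) i)
    exact this
  add_left f g h := by
    refine Finsupp.sum_add_index' (fun s => ?_) (fun s a b => ?_)
    · simp [Finsupp.sum]
    · simp [Finsupp.sum, ← Finset.sum_add_distrib, add_mul]
  smul_left f g r := by
    refine (Finsupp.sum_smul_index' (fun s => ?_)).trans ?_
    · simp [Finsupp.sum]
    · simp only [innerStep, Finsupp.sum, Finset.mul_sum, smul_eq_mul, conj_trivial]
      refine Finset.sum_congr rfl fun s _ => Finset.sum_congr rfl fun t _ => ?_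
      ring

instance : SeminormedAddCommGroup (StepFn H T) :=
  @InnerProductSpace.Core.toSeminormedAddCommGroup ℝ (StepFn H T) _ _ _ (core H T)

instance : InnerProductSpace ℝ (StepFn H T) := InnerProductSpace.ofCore (core H T)

end StepFn

/-- The Hilbert space `𝔥`: the completion of the step functions. -/
abbrev CMSpace (H : Set.Ioo (0 : ℝ) 1) (T : ℝ) : Type := UniformSpace.Completion (StepFn H T)

/-- The step function `1_{[0,t]}`, for `t ∈ [0, T]`. -/
def StepFn.basisFn (H : Set.Ioo (0 : ℝ) 1) (T : ℝ) (t : Set.Icc (0 : ℝ) T) : StepFn H T :=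
  (Finsupp.single t (1 : ℝ) : Set.Icc (0 : ℝ) T →₀ ℝ)

open Classical in
/-- The step function `1_{[0,t]}`, for a real number `t` (used for `t ∈ [0, T]` only). -/
def indStep (H : Set.Ioo (0 : ℝ) 1) (T t : ℝ) : StepFn H T :=
  if h : t ∈ Set.Icc (0 : ℝ) T then StepFn.basisFn H T ⟨t, h⟩ else 0

/-- `1_{[0,t]}` as an element of `𝔥`, for `t ∈ [0, T]`. -/
def ind (H : Set.Ioo (0 : ℝ) 1) (T t : ℝ) : CMSpace H T :=
  ((indStep H T t : StepFn H T) : UniformSpace.Completion (StepFn H T))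

theorem inner_ind (H : Set.Ioo (0 : ℝ) 1) {T s t : ℝ} (hs : s ∈ Set.Icc 0 T)
    (ht : t ∈ Set.Icc 0 T) : ⟪ind H T t, ind H T s⟫_ℝ = covKernel H s t := by
  rw [real_inner_comm, ind, ind, UniformSpace.Completion.inner_coe, indStep, indStep, dif_pos hs,
    dif_pos ht]
  change StepFn.innerStep H T (Finsupp.single _ _) (Finsupp.single _ _) = _
  simp [StepFn.innerStep]

section Isonormal

variable {𝔥 Ω : Type*} [NormedAddCommGroup 𝔥] [InnerProductSpace ℝ 𝔥] {mΩ : MeasurableSpace Ω}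

/-- An isonormal Gaussian process over the Hilbert space `𝔥`. -/
structure IsIsonormal (W : 𝔥 → Ω → ℝ) (P : Measure Ω) : Prop where
  isGaussianProcess : IsGaussianProcess W P
  mean_zero : ∀ h, ∫ ω, W h ω ∂P = 0
  covariance : ∀ g h, ∫ ω, W g ω * W h ω ∂P = ⟪g, h⟫_ℝ

namespace IsIsonormal

variable {W : 𝔥 → Ω → ℝ} {P : Measure Ω}

theorem memLp (hW : IsIsonormal W P) (h : 𝔥) : MemLp (W h) 2 P :=
  (hW.isGaussianProcess.hasGaussianLaw_eval h).memLp_two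

theorem ae_eq_smul_add (hW : IsIsonormal W P) (c : ℝ) (g h : 𝔥) :
    W (c • g + h) =ᵐ[P] fun ω => c * W g ω + W h ω := by
  have i : ∀ a b, Integrable (fun ω => W a ω * W b ω) P := fun a b =>
    (hW.memLp a).integrable_mul (hW.memLp b)
  have hmem : MemLp (fun ω => W (c • g + h) ω - (c * W g ω + W h ω)) 2 P :=
    (hW.memLp _).sub (((hW.memLp g).const_mul c).add (hW.memLp h))
  set k := c • g + h with hk
  have e : ∀ ω, (W k ω - (c * W g ω + W h ω)) ^ 2 =
      W k ω * W k ω + c ^ 2 * (W g ω * W g ω) + W h ω * W h ω - 2 * c * (W k ω * W g ω)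
        - 2 * (W k ω * W h ω) + 2 * c * (W g ω * W h ω) := fun ω => by ring
  have h0 : ∫ ω, (W k ω - (c * W g ω + W h ω)) ^ 2 ∂P = 0 := by
    simp_rw [e]
    rw [integral_add, integral_sub, integral_sub, integral_add, integral_add, integral_const_mul,
      integral_const_mul, integral_const_mul, integral_const_mul]
    · simp only [hW.covariance, hk, inner_add_left, inner_add_right, real_inner_smul_left,
        real_inner_smul_right, real_inner_comm g h]
      ring
    all_goals
      first
      | exact i _ _
      | exact (i _ _).const_mul _
      | fun_prop (disch := assumption)
  have h1 := (integral_eq_zero_iff_of_nonneg (fun ω => sq_nonneg _) hmem.integrable_sq).1 h0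
  filter_upwards [h1] with ω hω
  have : W k ω - (c * W g ω + W h ω) = 0 := by simpa using hω
  linarith

theorem aestronglyMeasurable_wick (hW : IsIsonormal W P) (g h : 𝔥) :
    AEStronglyMeasurable (fun ω => W g ω * W h ω - ⟪g, h⟫_ℝ) P :=
  ((hW.memLp g).aestronglyMeasurable.mul (hW.memLp h).aestronglyMeasurable).sub
    aestronglyMeasurable_const

/-- The random variable `W(g) W(h) - ⟨g, h⟩`, modulo almost sure equality. -/
def wick (hW : IsIsonormal W P) (g h : 𝔥) : Ω →ₘ[P] ℝ :=
  AEEqFun.mk (fun ω => W g ω * W h ω - ⟪g, h⟫_ℝ) (hW.aestronglyMeasurable_wick g h)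

theorem wick_symm (hW : IsIsonormal W P) (g h : 𝔥) : hW.wick g h = hW.wick h g := by
  rw [wick, wick, AEEqFun.mk_eq_mk]
  exact Eventually.of_forall fun ω => by simp only [real_inner_comm, mul_comm]

theorem wick_add (hW : IsIsonormal W P) (g g' h : 𝔥) :
    hW.wick (g + g') h = hW.wick g h + hW.wick g' h := by
  rw [wick, wick, wick, AEEqFun.mk_add_mk, AEEqFun.mk_eq_mk]
  filter_upwards [hW.ae_eq_smul_add 1 g g'] with ω h1
  rw [one_smul, one_mul] at h1
  simp only [Pi.add_apply, h1, inner_add_left]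
  ring

theorem wick_smul (hW : IsIsonormal W P) (c : ℝ) (g h : 𝔥) :
    hW.wick (c • g) h = c • hW.wick g h := by
  rw [wick, wick, AEEqFun.smul_mk, AEEqFun.mk_eq_mk]
  filter_upwards [hW.ae_eq_smul_add c g 0, hW.ae_eq_smul_add 1 0 0] with ω h1 h2
  simp only [smul_zero, add_zero, one_mul] at h1 h2
  have h3 : W 0 ω = 0 := by linarith
  simp only [Pi.smul_apply, smul_eq_mul, h1, h3, real_inner_smul_left]
  ring

/-- The double Wiener integral, on the algebraic tensor product (which contains all the kernels
used below): the linear map with `I₂(g ⊗ h) = W(g) W(h) - ⟨g, h⟩`; it depends on the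
symmetrization of the kernel only, and `I₂(h ⊗ h) = W(h)² - ‖h‖²`. -/
def I₂ (hW : IsIsonormal W P) : 𝔥 ⊗[ℝ] 𝔥 →ₗ[ℝ] (Ω →ₘ[P] ℝ) :=
  TensorProduct.lift (LinearMap.mk₂ ℝ hW.wick hW.wick_add hW.wick_smul
    (fun g h h' => by
      rw [hW.wick_symm, hW.wick_add, hW.wick_symm h, hW.wick_symm h'])
    (fun c g h => by rw [hW.wick_symm, hW.wick_smul, hW.wick_symm h]))

end IsIsonormal

/-- The contraction `⊗₁`, with `(a ⊗ b) ⊗₁ (c ⊗ d) = ⟨a, c⟩ b ⊗ d`. -/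
def contr₁ (f g : 𝔥 ⊗[ℝ] 𝔥) : 𝔥 ⊗[ℝ] 𝔥 :=
  TensorProduct.lid ℝ (𝔥 ⊗[ℝ] 𝔥)
    (TensorProduct.map (TensorProduct.lift (innerₗ 𝔥)) LinearMap.id
      (TensorProduct.tensorTensorTensorComm ℝ 𝔥 𝔥 𝔥 𝔥 (f ⊗ₜ g)))

/-- The symmetrized contraction `⊙₁`. -/
def symContr₁ (f g : 𝔥 ⊗[ℝ] 𝔥) : 𝔥 ⊗[ℝ] 𝔥 :=
  (1 / 2 : ℝ) • (contr₁ f g + TensorProduct.comm ℝ 𝔥 𝔥 (contr₁ f g))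

end Isonormal

section Model

/-- The sampling point `t_x^m = x T / m`. -/
def grid (T : ℝ) (m : ℕ) (x : ℝ) : ℝ := x * T / m

/-- `1_{j+1}^m - 1_j^m`, where `1_j^m` is the indicator function of `(t_{j-1}^m, t_j^m]`. -/
def stepDiff (H : Set.Ioo (0 : ℝ) 1) (T : ℝ) (m j : ℕ) : CMSpace H T :=
  (ind H T (grid T m (j + 1)) - ind H T (grid T m j))
    - (ind H T (grid T m j) - ind H T (grid T m (j - 1)))

variable {H : Set.Ioo (0 : ℝ) 1} {T : ℝ} {Ω : Type*} {mΩ : MeasurableSpace Ω}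

/-- The fractional Brownian motion `B_t = W(1_{[0,t]})`, `t ∈ [0, T]`. -/
def fBM (W : CMSpace H T → Ω → ℝ) (t : ℝ) (ω : Ω) : ℝ := W (ind H T t) ω

/-- The second order difference `d_{n,j} = B_{t_{j+1}} - 2 B_{t_j} + B_{t_{j-1}}`. -/
def secondDiff (W : CMSpace H T → Ω → ℝ) (n j : ℕ) (ω : Ω) : ℝ :=
  fBM W (grid T n (j + 1)) ω - 2 * fBM W (grid T n j) ω + fBM W (grid T n (j - 1)) ω

/-- The sum of squares `V_{n,T}^{(2)} = ∑_{j=1}^{n-1} d_{n,j}²`. -/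
def V₂ (W : CMSpace H T → Ω → ℝ) (n : ℕ) (ω : Ω) : ℝ :=
  ∑ j ∈ Finset.Ico 1 n, secondDiff W n j ω ^ 2

/-- The expectation of `V_{n,T}^{(2)}`. -/
def meanV₂ (W : CMSpace H T → Ω → ℝ) (P : Measure Ω) (n : ℕ) : ℝ := ∫ ω, V₂ W n ω ∂P

/-- `M_n = -√n {(V_{2n,T} / E[V_{2n,T}] - 1) - (V_{n,T} / E[V_{n,T}] - 1)}`. -/
def M (W : CMSpace H T → Ω → ℝ) (P : Measure Ω) (n : ℕ) (ω : Ω) : ℝ :=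
  -√n * ((V₂ W (2 * n) ω / meanV₂ W P (2 * n) - 1) - (V₂ W n ω / meanV₂ W P n - 1))

/-- The kernel `f_n^{[α]} = √n ∑_{j=1}^{αn-1} (1_{j+1}^{αn} - 1_j^{αn})^{⊗2} / E[V_{αn,T}]`. -/
def kern (W : CMSpace H T → Ω → ℝ) (P : Measure Ω) (α n : ℕ) : CMSpace H T ⊗[ℝ] CMSpace H T :=
  (√n / meanV₂ W P (α * n)) •
    ∑ j ∈ Finset.Ico 1 (α * n), stepDiff H T (α * n) j ⊗ₜ[ℝ] stepDiff H T (α * n) j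

/-- `G̃_n = 2 I₂(f_n^{[2]} ⊗₁ f_n^{[2]}) - 4 I₂(f_n^{[2]} ⊙₁ f_n^{[1]})
+ 2 I₂(f_n^{[1]} ⊗₁ f_n^{[1]})`. -/
def Gtilde {W : CMSpace H T → Ω → ℝ} {P : Measure Ω} (hW : IsIsonormal W P) (n : ℕ) :
    Ω →ₘ[P] ℝ :=
  (2 : ℝ) • hW.I₂ (contr₁ (kern W P 2 n) (kern W P 2 n))
    - (4 : ℝ) • hW.I₂ (symContr₁ (kern W P 2 n) (kern W P 1 n))
    + (2 : ℝ) • hW.I₂ (contr₁ (kern W P 1 n) (kern W P 1 n))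

end Model

section Constants

variable (H : ℝ)

/-- The correlation function `ρ̂`. -/
def rhoHat (j : ℤ) : ℝ :=
  1 / 2 * (-|(j : ℝ) - 2| ^ (2 * H) + 4 * |(j : ℝ) - 1| ^ (2 * H) - 6 * |(j : ℝ)| ^ (2 * H)
    + 4 * |(j : ℝ) + 1| ^ (2 * H) - |(j : ℝ) + 2| ^ (2 * H))

/-- The correlation function `ρ̃`. -/
def rhoTilde (j : ℤ) : ℝ :=
  1 / 2 ^ (2 * H + 1) * (-|(j : ℝ) - 3| ^ (2 * H) + 2 * |(j : ℝ) - 2| ^ (2 * H)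
    + |(j : ℝ) - 1| ^ (2 * H) - 4 * |(j : ℝ)| ^ (2 * H) + |(j : ℝ) + 1| ^ (2 * H)
    + 2 * |(j : ℝ) + 2| ^ (2 * H) - |(j : ℝ) + 3| ^ (2 * H))

/-- The constant `4 - 2^{2H}`. -/
def cH : ℝ := 4 - 2 ^ (2 * H)

/-- The general term of the series in `Σ₁₁`, indexed by `i = k + 1 ≥ 1`. -/
def term11 (k : ℕ) : ℝ := rhoHat H (k + 1) ^ 2

/-- The general term of the series in `Σ₁₂`. -/
def term12 (l : ℤ) : ℝ := rhoTilde H l ^ 2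

/-- The constant `Σ₁₁`. -/
def Sigma11 : ℝ := 2 * (1 + 2 / cH H ^ 2 * ∑' k, term11 H k)

/-- The constant `Σ₂₂`. -/
def Sigma22 : ℝ := 1 / 2 * Sigma11 H

/-- The constant `Σ₁₂`. -/
def Sigma12 : ℝ := 2 ^ (2 * H) / cH H ^ 2 * ∑' l, term12 H l

/-- The constant `G_∞`. -/
def Ginf : ℝ := Sigma22 H - 2 * Sigma12 H + Sigma11 H

/-- The general term of the series in `κ(1;1,1)`. -/
def term1_11 (i : ℤ × ℤ) : ℝ := rhoHat H i.1 * rhoHat H (i.1 - i.2) * rhoHat H i.2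

/-- The general term of the series in `κ(2;1,1)`. -/
def term2_11 (i : ℤ × ℤ) : ℝ := rhoHat H i.1 * rhoTilde H (i.2 - 2 * i.1) * rhoTilde H i.2

/-- The general term of the series in `κ(1;2,2)`. -/
def term1_22 (i : ℤ × ℤ) : ℝ := rhoHat H i.1 * rhoTilde H (i.1 - i.2) * rhoTilde H i.2

/-- The general term of the series in `κ(1,1;1,1)`. -/
def term11_11 (i : ℤ × ℤ × ℤ) : ℝ :=
  rhoHat H i.1 * rhoHat H (i.1 - i.2.1) * rhoHat H (i.2.1 - i.2.2) * rhoHat H i.2.2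

/-- The general term of the series in `κ(1,1;2,2)`. -/
def term11_22 (i : ℤ × ℤ × ℤ) : ℝ :=
  rhoTilde H (2 * i.1) * rhoHat H (i.1 - i.2.1) * rhoTilde H (2 * i.2.1 - i.2.2) * rhoHat H i.2.2
    + rhoTilde H (2 * i.1 + 1) * rhoHat H (i.1 - i.2.1) * rhoTilde H (2 * i.2.1 - i.2.2 + 1)
      * rhoHat H i.2.2

/-- The general term of the series in `κ(1,1;1,2)`. -/
def term11_12 (i : ℤ × ℤ × ℤ) : ℝ :=
  rhoHat H i.1 * rhoTilde H (2 * i.1 - i.2.1) * rhoTilde H (i.2.1 - 2 * i.2.2) * rhoHat H i.2.2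

/-- The general term of the series in `κ(1,2;2,2)`. -/
def term12_22 (i : ℤ × ℤ × ℤ) : ℝ :=
  rhoHat H i.1 * rhoHat H (i.1 - i.2.1) * rhoTilde H (i.2.1 - i.2.2) * rhoTilde H i.2.2

/-- The general term of the series in `κ(1,2;1,2)₁`. -/
def term12_12a (i : ℤ × ℤ × ℤ) : ℝ :=
  rhoHat H i.1 * rhoTilde H (2 * i.1 - i.2.1) * rhoHat H (i.2.1 - i.2.2) * rhoTilde H i.2.2

/-- The general term of the first series in `κ(1,2;1,2)₂`. -/
def term12_12b (i : ℤ × ℤ × ℤ) : ℝ :=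
  rhoTilde H (2 * i.1) * rhoTilde H (2 * i.1 - i.2.1) * rhoTilde H (i.2.1 - 2 * i.2.2)
    * rhoTilde H (2 * i.2.2)

/-- The general term of the second series in `κ(1,2;1,2)₂`. -/
def term12_12c (i : ℤ × ℤ × ℤ) : ℝ :=
  rhoTilde H (2 * i.1 + 1) * rhoTilde H (2 * i.1 - i.2.1) * rhoTilde H (i.2.1 - 2 * i.2.2)
    * rhoTilde H (2 * i.2.2 + 1)

/-- All the series that define the constants converge absolutely. -/
def SeriesConverge : Prop :=
  Summable (term11 H) ∧ Summable (term12 H) ∧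
  Summable (term1_11 H) ∧ Summable (term2_11 H) ∧ Summable (term1_22 H) ∧
  Summable (term11_11 H) ∧ Summable (term11_22 H) ∧ Summable (term11_12 H) ∧
  Summable (term12_22 H) ∧
  Summable (term12_12a H) ∧ Summable (term12_12b H) ∧ Summable (term12_12c H)

/-- The constant `κ(1;1,1)`. -/
def kappa1_11 : ℝ := 1 / cH H ^ 3 * ∑' i, term1_11 H i

/-- The constant `κ(2;1,1)`. -/
def kappa2_11 : ℝ := 2 ^ (2 * H - 1) / cH H ^ 3 * ∑' i, term2_11 H i

/-- The constant `κ(1;2,2)`. -/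
def kappa1_22 : ℝ := 2 ^ (2 * H - 2) / cH H ^ 3 * ∑' i, term1_22 H i

/-- The constant `κ(2;2,2)`; the factor comes from `f_n^{[2]} = 2^{-1/2} f_{2n}^{[1]}`. -/
def kappa2_22 : ℝ := 1 / 4 * kappa1_11 H

/-- The constant `κ(1;1,2)`, which is `κ(2;1,1)`. -/
def kappa1_12 : ℝ := kappa2_11 H

/-- The constant `κ(2;1,2)`, which is `κ(1;2,2)`. -/
def kappa2_12 : ℝ := kappa1_22 H

/-- The constant `κ(1,1;1,1)`. -/
def kappa11_11 : ℝ := 1 / cH H ^ 4 * ∑' i, term11_11 H i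

/-- The constant `κ(2,2;2,2)`; the factor comes from `f_n^{[2]} = 2^{-1/2} f_{2n}^{[1]}`. -/
def kappa22_22 : ℝ := 1 / 8 * kappa11_11 H

/-- The constant `κ(1,1;2,2)`. -/
def kappa11_22 : ℝ := 2 ^ (2 * H - 2) / cH H ^ 4 * ∑' i, term11_22 H i

/-- The constant `κ(1,1;1,2)`. -/
def kappa11_12 : ℝ := 2 ^ (2 * H - 1) / cH H ^ 4 * ∑' i, term11_12 H i

/-- The constant `κ(1,2;2,2)`. -/
def kappa12_22 : ℝ := 2 ^ (2 * H - 3) / cH H ^ 4 * ∑' i, term12_22 H i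

/-- The constant `κ(1,2;1,2) = κ(1,2;1,2)₁ + κ(1,2;1,2)₂`. -/
def kappa12_12 : ℝ :=
  2 ^ (2 * H - 3) / cH H ^ 4 * ∑' i, term12_12a H i
    + 2 ^ (4 * H - 3) / cH H ^ 4 * (∑' i, term12_12b H i + ∑' i, term12_12c H i)

/-- The entry `𝔘₁₃`. -/
def U13 : ℝ := 4 * kappa1_22 H - 8 * kappa1_12 H + 4 * kappa1_11 H

/-- The entry `𝔘₂₃`. -/
def U23 : ℝ := 4 * kappa2_22 H - 8 * kappa2_12 H + 4 * kappa2_11 H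

/-- The entry `𝔘₃₃`. -/
def U33 : ℝ :=
  8 * kappa22_22 H + 32 * kappa12_12 H + 8 * kappa11_11 H
    - 32 * kappa12_22 H + 16 * kappa11_22 H - 32 * kappa11_12 H

/-- The symmetric matrix `𝔘`. -/
def matU : Matrix (Fin 3) (Fin 3) ℝ :=
  !![Sigma11 H, Sigma12 H, U13 H;
     Sigma12 H, Sigma22 H, U23 H;
     U13 H, U23 H, U33 H]

/-- The symmetric matrix `𝔗`. -/
def matT : Matrix (Fin 2) (Fin 2) ℝ :=
  !![matU H 0 0 - 2 * matU H 0 1 + matU H 1 1, matU H 0 2 - matU H 1 2;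
     matU H 0 2 - matU H 1 2, matU H 2 2]

end Constants

end

end FracBM

/-! Put `g_n = f_n^{[1]} - f_n^{[2]}` (`kernDiff`). Then `M_n = I₂(g_n)` and `G̃_n = 2 I₂(g_n ⊗₁
g_n)` (`M_ae_eq`, `Gtilde_eq`), so both coordinates come from one symmetric tensor of finite rank.
Diagonalise it as `g_n = ∑ lᵢ eᵢ ⊗ eᵢ` with orthonormal `eᵢ` (`exists_orthonormal_sum_tmul`). The
variables `ξᵢ = W(eᵢ)` are independent standard normal, and `T_n = (∑ lᵢ (ξᵢ² - 1), ∑ 2√n lᵢ² (ξᵢ² -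
1))`. Its characteristic function is therefore a product, and that of `ξ² - 1` is `exp(-t²) +
o(t²)`. Hence the product converges to `exp(-s)` once `∑ (t₀ lᵢ + 2√n t₁ lᵢ²)²` converges to `s` and
`√n max |lᵢ|` stays bounded (`tendsto_prod_charFun_chiLaw`, `IsIsonormal.tendstoInDistribution`).

The eigenvalue bound is Schur's test (`sum_inner_sq_le`, `exists_bound_kernDiff`). It uses that `ρ̂`
is summable, being a fourth difference of `|x|^{2H}` and hence of order `|j|^{2H-4}`.

What remains is the limit of `∑ lᵢ²`, `√n ∑ lᵢ³` and `n ∑ lᵢ⁴`. These power sums are inner products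
of `g_n` and `g_n ⊗₁ g_n`, and expand into sums over cycles of two, three or four second differences
taken on the coarse or the fine grid. The Gram entries are `ρ̂` and `ρ̃` at index differences, so
each cyclic sum, up to scaling, sums translates of a summable kernel over a base vertex; its average
tends to the corresponding series (`tendsto_average_translates`).

Positive semidefiniteness is inherited from the limit, the quadratic form being a limit of sums of
squares. The lower bound on `G_∞` follows from `√2 Σ₁₂ ≤ Σ₁₁`, which is the limit of `‖f_n^{[1]} -
√2 f_n^{[2]}‖² ≥ 0`. -/

namespace FracBM

open scoped Topology Asymptotics

/-! ### Gaussian limits of weighted sums of centred squared normals. -/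

section GaussianLimit

theorem integral_pow_four_stdGaussian : ∫ x, x ^ 4 ∂gaussianReal 0 1 = 3 := by
  have h1 : ∀ x : ℝ, gaussianPDFReal 0 1 x • x ^ 4 =
      (√(2 * Real.pi))⁻¹ * (|x| ^ (4 : ℝ) * Real.exp (-(1 / 2) * |x| ^ (2 : ℝ))) := by
    intro x
    have e4 : |x| ^ (4 : ℝ) = x ^ 4 := by
      rw [show (4 : ℝ) = ((4 : ℕ) : ℝ) by norm_num, Real.rpow_natCast]
      exact Even.pow_abs ⟨2, rfl⟩ x
    have e2 : |x| ^ (2 : ℝ) = x ^ 2 := by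
      rw [show (2 : ℝ) = ((2 : ℕ) : ℝ) by norm_num, Real.rpow_natCast]
      exact Even.pow_abs ⟨1, rfl⟩ x
    rw [e4, e2, gaussianPDFReal]
    simp only [NNReal.coe_one, mul_one, sub_zero, smul_eq_mul]
    rw [show -x ^ 2 / 2 = -(1 / 2) * x ^ 2 by ring]
    ring
  rw [integral_gaussianReal_eq_integral_smul one_ne_zero]
  simp_rw [h1]
  rw [integral_const_mul, integral_comp_abs
    (f := fun x : ℝ => x ^ (4 : ℝ) * Real.exp (-(1 / 2) * x ^ (2 : ℝ))),
    integral_rpow_mul_exp_neg_mul_rpow (by norm_num) (by norm_num) (by norm_num)]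
  have hG : Real.Gamma ((4 + 1) / 2) = 3 / 4 * √Real.pi := by
    have := Real.Gamma_nat_add_half 2
    norm_num at this ⊢
    rw [this]
    ring
  have hp : (1 / 2 : ℝ) ^ (-(4 + 1) / 2 : ℝ) = 4 * √2 := by
    rw [show (-(4 + 1) / 2 : ℝ) = -(2 + 1 / 2) by norm_num, one_div,
      Real.inv_rpow (by norm_num), Real.rpow_neg (by norm_num), inv_inv,
      Real.rpow_add (by norm_num), Real.sqrt_eq_rpow]
    norm_num
  have hπ : √Real.pi ≠ 0 := (Real.sqrt_pos.2 Real.pi_pos).ne'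
  rw [hG, hp, Real.sqrt_mul (by norm_num)]
  field_simp

theorem memLp_id_stdGaussian (p : ENNReal) (hp : p ≠ ⊤) : MemLp (fun x : ℝ => x) p (gaussianReal 0 1) :=
  memLp_id_gaussianReal' p hp

theorem integrable_pow_stdGaussian (k : ℕ) : Integrable (fun x : ℝ => x ^ k) (gaussianReal 0 1) := by
  have h := (memLp_id_stdGaussian k (by simp)).integrable_norm_pow'
  refine Integrable.mono' h (by fun_prop) (Eventually.of_forall fun x => ?_)
  simp

theorem integral_sq_stdGaussian : ∫ x, x ^ 2 ∂gaussianReal 0 1 = 1 := by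
  have h := variance_fun_id_gaussianReal (μ := 0) (v := 1)
  rw [variance_eq_integral (by fun_prop)] at h
  simpa [integral_id_gaussianReal] using h

/-- The law of `ξ² - 1`, where `ξ` is a standard normal variable. -/
noncomputable def chiLaw : Measure ℝ := (gaussianReal 0 1).map fun x => x ^ 2 - 1

instance : IsProbabilityMeasure chiLaw :=
  Measure.isProbabilityMeasure_map (by fun_prop)

/-- Since `ξ² - 1` is centred with variance 2, the expansion is `1 - t² + o(t²)`. Comparing with
`exp(-t²)` instead of `1 - t²` gives factors whose product is exactly a Gaussian characteristic
function. -/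
theorem charFun_chiLaw_isLittleO :
    (fun t : ℝ => charFun chiLaw t - Complex.exp (-(t : ℂ) ^ 2)) =o[𝓝 0] fun t : ℝ => t ^ 2 := by
  have h2 : (√2 : ℝ) ≠ 0 := by positivity
  have i2 := integrable_pow_stdGaussian 2
  have i4 := integrable_pow_stdGaussian 4
  -- The factor `1/√2` normalises the variance `3 - 2 + 1 = 2` to one; it is undone below by the
  -- substitution `t ↦ √2 t`.
  have h := taylor_charFun_two (P := gaussianReal 0 1) (X := fun x => (√2)⁻¹ * (x ^ 2 - 1))
    (by fun_prop)
    (by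
      rw [integral_const_mul, integral_sub i2 (integrable_const _), integral_sq_stdGaussian]
      simp)
    (by
      have e : ∀ x : ℝ, ((fun x : ℝ => (√2)⁻¹ * (x ^ 2 - 1)) ^ 2) x =
          1 / 2 * (x ^ 4 - 2 * x ^ 2 + 1) := fun x => by
        simp only [Pi.pow_apply, mul_pow, inv_pow, Real.sq_sqrt (zero_le_two (α := ℝ))]
        ring
      simp_rw [e]
      rw [integral_const_mul, integral_add (by fun_prop) (integrable_const _),
        integral_sub i4 (by fun_prop), integral_const_mul, integral_sq_stdGaussian,
        integral_pow_four_stdGaussian]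
      norm_num)
  have hl : Tendsto (fun t : ℝ => √2 * t) (𝓝 0) (𝓝 0) := by
    simpa using (continuous_const_mul (√2 : ℝ)).tendsto (0 : ℝ)
  have h' := h.comp_tendsto hl
  have hA : (fun t : ℝ => charFun chiLaw t - (1 - (t : ℂ) ^ 2)) =o[𝓝 0] fun t : ℝ => t ^ 2 := by
    have e1 : (fun t : ℝ => charFun chiLaw t - (1 - (t : ℂ) ^ 2)) =
        (fun t : ℝ => charFun ((gaussianReal 0 1).map fun x => (√2)⁻¹ * (x ^ 2 - 1)) t
          - (1 - (t : ℂ) ^ 2 / 2)) ∘ fun t => √2 * t := by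
      funext t
      simp only [Function.comp_apply]
      rw [charFun_map_mul_comp (by fun_prop), ← mul_assoc, inv_mul_cancel₀ h2, one_mul, chiLaw]
      congr 2
      push_cast
      rw [mul_pow, ← Complex.ofReal_pow √2, Real.sq_sqrt (zero_le_two (α := ℝ))]
      push_cast; ring
    rw [e1]
    refine h'.trans_isBigO (Asymptotics.IsBigO.of_bound 2 (Eventually.of_forall fun t => ?_))
    simp [mul_pow]
  have hB : (fun t : ℝ => (1 - (t : ℂ) ^ 2) - Complex.exp (-(t : ℂ) ^ 2)) =o[𝓝 0]
      fun t : ℝ => t ^ 2 := by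
    have hd : (fun z : ℂ => Complex.exp z - Complex.exp 0 - (z - 0) * Complex.exp 0) =o[𝓝 0]
        fun z => z - 0 := by
      simpa using (hasDerivAt_iff_isLittleO.1 (Complex.hasDerivAt_exp 0))
    have hc : Tendsto (fun t : ℝ => -(t : ℂ) ^ 2) (𝓝 0) (𝓝 0) := by
      have : Continuous fun t : ℝ => -(t : ℂ) ^ 2 := by fun_prop
      simpa using this.tendsto 0
    have := (hd.comp_tendsto hc).neg_left
    refine (this.congr_left fun t => ?_).trans_isBigO
      (Asymptotics.IsBigO.of_bound 1 (Eventually.of_forall fun t => ?_))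
    · simp; ring
    · simp
  exact (hA.add hB).congr_left fun t => by ring

/-- Telescoping: the factors are exchanged one at a time, and the remaining ones have modulus at
most one. -/
theorem norm_prod_sub_prod_le {ι : Type*} (s : Finset ι) (a b : ι → ℂ) (ha : ∀ i ∈ s, ‖a i‖ ≤ 1)
    (hb : ∀ i ∈ s, ‖b i‖ ≤ 1) : ‖∏ i ∈ s, a i - ∏ i ∈ s, b i‖ ≤ ∑ i ∈ s, ‖a i - b i‖ := by
  classical
  induction s using Finset.induction_on with
  | empty => simp
  | insert i s hi ih =>
    rw [Finset.prod_insert hi, Finset.prod_insert hi, Finset.sum_insert hi]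
    have ih' := ih (fun j hj => ha j (Finset.mem_insert_of_mem hj))
      (fun j hj => hb j (Finset.mem_insert_of_mem hj))
    have e : a i * ∏ j ∈ s, a j - b i * ∏ j ∈ s, b j =
        (a i - b i) * ∏ j ∈ s, a j + b i * (∏ j ∈ s, a j - ∏ j ∈ s, b j) := by ring
    have hp : ‖∏ j ∈ s, a j‖ ≤ 1 := by
      rw [norm_prod]
      exact Finset.prod_le_one (fun _ _ => norm_nonneg _)
        fun j hj => ha j (Finset.mem_insert_of_mem hj)
    rw [e]
    refine (norm_add_le _ _).trans ?_
    rw [norm_mul, norm_mul]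
    have := hb i (Finset.mem_insert_self _ _)
    gcongr
    · exact mul_le_of_le_one_right (norm_nonneg _) hp
    · exact (mul_le_of_le_one_left (norm_nonneg _) this).trans ih'

/-- The characteristic functions of `∑ μᵢ (ξᵢ² - 1)`, with independent standard normal `ξᵢ`,
converge to a Gaussian one if `∑ μᵢ²` converges and `max |μᵢ|` tends to zero. -/
theorem tendsto_prod_charFun_chiLaw {d : ℕ → ℕ} (μ : ∀ n, Fin (d n) → ℝ) {r : ℕ → ℝ}
    (hr : Tendsto r atTop (𝓝 0)) (hμ : ∀ᶠ n in atTop, ∀ i, |μ n i| ≤ r n) {s : ℝ}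
    (hs : Tendsto (fun n => ∑ i, μ n i ^ 2) atTop (𝓝 s)) :
    Tendsto (fun n => ∏ i, charFun chiLaw (μ n i)) atTop (𝓝 (Complex.exp (-s))) := by
  have hexp : Tendsto (fun n => ∏ i, Complex.exp (-(μ n i : ℂ) ^ 2)) atTop
      (𝓝 (Complex.exp (-s))) := by
    have e : ∀ n, ∏ i, Complex.exp (-(μ n i : ℂ) ^ 2) =
        Complex.exp (-((∑ i, μ n i ^ 2 : ℝ) : ℂ)) := fun n => by
      rw [← Complex.exp_sum]
      push_cast
      rw [Finset.sum_neg_distrib]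
    simp_rw [e]
    exact (Complex.continuous_exp.tendsto _).comp
      ((Complex.continuous_ofReal.tendsto _).comp hs).neg
  have hdiff : Tendsto (fun n => ∏ i, charFun chiLaw (μ n i) -
      ∏ i, Complex.exp (-(μ n i : ℂ) ^ 2)) atTop (𝓝 0) := by
    rw [Metric.tendsto_nhds]
    intro ε hε
    have hs0 : 0 ≤ s := ge_of_tendsto' hs fun n => Finset.sum_nonneg fun i _ => sq_nonneg _
    -- Eventually `∑ μᵢ² < s + 1`, so errors of size `η μᵢ²` per factor add up to less than `ε`.
    obtain ⟨η, hη, hηε⟩ : ∃ η, 0 < η ∧ η * (s + 1) < ε :=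
      ⟨ε / (2 * (s + 1)), by positivity, by field_simp; linarith⟩
    have hl := charFun_chiLaw_isLittleO.bound hη
    rw [Metric.eventually_nhds_iff] at hl
    obtain ⟨δ, hδ, hl⟩ := hl
    filter_upwards [hμ, hr.eventually (gt_mem_nhds hδ), hs.eventually (gt_mem_nhds (lt_add_one s))]
      with n h1 h2 h3
    rw [dist_zero_right]
    calc _ ≤ ∑ i, ‖charFun chiLaw (μ n i) - Complex.exp (-(μ n i : ℂ) ^ 2)‖ := by
          refine norm_prod_sub_prod_le _ _ _ (fun i _ => norm_charFun_le_one _) fun i _ => ?_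
          rw [← Complex.ofReal_pow, ← Complex.ofReal_neg, ← Complex.ofReal_exp, Complex.norm_real,
            Real.norm_of_nonneg (Real.exp_nonneg _)]
          exact Real.exp_le_one_iff.2 (by nlinarith [sq_nonneg (μ n i)])
      _ ≤ ∑ i, η * μ n i ^ 2 := by
          refine Finset.sum_le_sum fun i _ => ?_
          have := hl (y := μ n i) (by
            rw [dist_zero_right, Real.norm_eq_abs]; exact (h1 i).trans_lt h2)
          simpa using this
      _ ≤ η * (s + 1) := by rw [← Finset.mul_sum]; gcongr
      _ < ε := hηε
  simpa using hdiff.add hexp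

end GaussianLimit

/-! ### Independent standard normal coordinates along orthonormal vectors. -/

section Isonormal

variable {𝔥 Ω : Type*} [NormedAddCommGroup 𝔥] [InnerProductSpace ℝ 𝔥] {mΩ : MeasurableSpace Ω}
  {P : Measure Ω} {W : 𝔥 → Ω → ℝ}

theorem IsIsonormal.aemeasurable (hW : IsIsonormal W P) (h : 𝔥) : AEMeasurable (W h) P :=
  hW.isGaussianProcess.aemeasurable h

theorem IsIsonormal.map_eq_gaussianReal (hW : IsIsonormal W P) {h : 𝔥} (hh : ‖h‖ = 1) :
    P.map (W h) = gaussianReal 0 1 := by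
  have := hW.isGaussianProcess.isProbabilityMeasure
  have h1 := (hW.isGaussianProcess.hasGaussianLaw_eval h).map_eq_gaussianReal
  rw [h1]
  have h2 := hW.mean_zero h
  have h3 : Var[W h; P] = 1 := by
    rw [variance_eq_integral (hW.aemeasurable h), h2]
    have := hW.covariance h h
    rw [real_inner_self_eq_norm_sq, hh] at this
    simpa [sq] using this
  rw [h3, h2]
  simp

/-- Orthogonality means zero covariance, which for jointly Gaussian variables is independence. -/
theorem IsIsonormal.iIndepFun_orthonormal [IsProbabilityMeasure P] (hW : IsIsonormal W P) {d : ℕ} {e : Fin d → 𝔥}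
    (he : Orthonormal ℝ e) : iIndepFun (fun i => W (e i)) P := by
  have hg : HasGaussianLaw (fun ω i => W (e i) ω) P := by
    have h := hW.isGaussianProcess.comp_right e
    have h' := h.hasGaussianLaw Finset.univ
    let L : (↥(Finset.univ : Finset (Fin d)) → ℝ) →L[ℝ] (Fin d → ℝ) :=
      ContinuousLinearMap.pi fun i => ContinuousLinearMap.proj ⟨i, Finset.mem_univ i⟩
    exact h'.map L
  refine hg.iIndepFun_of_covariance_eq_zero fun i j hij => ?_
  rw [covariance_eq_sub (hW.memLp _) (hW.memLp _), hW.mean_zero, zero_mul, sub_zero]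
  have := hW.covariance (e i) (e j)
  rw [he.2 hij] at this
  exact this

/-- Pairing the vector with `t` leaves the scalar `∑ (t₀ aᵢ + t₁ bᵢ)(ξᵢ² - 1)`, a sum of independent
terms, whose characteristic function is taken at 1. -/
theorem IsIsonormal.charFun_pair [IsProbabilityMeasure P] (hW : IsIsonormal W P) {d : ℕ} {e : Fin d → 𝔥}
    (he : Orthonormal ℝ e) (a b : Fin d → ℝ) (t : EuclideanSpace ℝ (Fin 2)) :
    charFun (P.map fun ω => (!₂[∑ i, a i * (W (e i) ω ^ 2 - 1), ∑ i, b i * (W (e i) ω ^ 2 - 1)] :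
      EuclideanSpace ℝ (Fin 2))) t = ∏ i, charFun chiLaw (t 0 * a i + t 1 * b i) := by
  have hmeas : ∀ i, AEMeasurable (W (e i)) P := fun i => hW.aemeasurable _
  set X : Fin d → Ω → ℝ := fun i ω => (t 0 * a i + t 1 * b i) * (W (e i) ω ^ 2 - 1) with hX
  have hXm : ∀ i, AEMeasurable (X i) P := fun i => by
    have := hmeas i
    fun_prop
  have hind : iIndepFun X P := (hW.iIndepFun_orthonormal he).comp
    (fun i x => (t 0 * a i + t 1 * b i) * (x ^ 2 - 1)) fun i => by fun_prop
  have h1 := congrFun (hind.charFun_map_fun_sum_eq_prod hXm) 1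
  rw [Finset.prod_apply] at h1
  have h2 : ∀ i, charFun (P.map (X i)) 1 = charFun chiLaw (t 0 * a i + t 1 * b i) := fun i => by
    have hl : P.map (fun ω => W (e i) ω ^ 2 - 1) = chiLaw := by
      rw [chiLaw, ← hW.map_eq_gaussianReal (he.1 i),
        AEMeasurable.map_map_of_aemeasurable (by fun_prop) (hmeas i)]
      rfl
    rw [hX, charFun_map_mul_comp (by have := hmeas i; fun_prop), mul_one, hl]
  simp_rw [h2] at h1
  rw [← h1, charFun_apply, charFun_apply, integral_map, integral_map]
  · refine integral_congr_ae (Eventually.of_forall fun ω => ?_)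
    simp only [X]
    congr 3
    simp only [PiLp.inner_apply, Fin.sum_univ_two, RCLike.inner_apply, conj_trivial]
    simp [Finset.mul_sum, ← Finset.sum_add_distrib]
    exact Finset.sum_congr rfl fun i _ => by ring
  · fun_prop
  · fun_prop
  · have : AEMeasurable (fun ω => ![∑ i, a i * (W (e i) ω ^ 2 - 1),
        ∑ i, b i * (W (e i) ω ^ 2 - 1)]) P := by
      refine aemeasurable_pi_iff.2 fun k => ?_
      fin_cases k
      · simp; fun_prop
      · simp; fun_prop
    exact (PiLp.continuous_toLp 2 _).measurable.comp_aemeasurable this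
  · fun_prop

end Isonormal

/-! ### Spectral form of diagonal tensors and of their contractions. -/

section Tensor

variable {𝔥 : Type*} [NormedAddCommGroup 𝔥] [InnerProductSpace ℝ 𝔥]

/-- A diagonal tensor is diagonalised by orthonormal eigenvectors. -/
theorem exists_orthonormal_sum_tmul {κ : Type*} [Fintype κ] (c : κ → ℝ) (v : κ → 𝔥) :
    ∃ (d : ℕ) (e : Fin d → 𝔥) (l : Fin d → ℝ), Orthonormal ℝ e ∧
      ∑ k, c k • (v k ⊗ₜ[ℝ] v k) = ∑ i, l i • (e i ⊗ₜ[ℝ] e i) ∧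
      ∀ i, l i = ∑ k, c k * ⟪v k, e i⟫_ℝ ^ 2 := by
  set E := Submodule.span ℝ (Set.range v) with hE
  have hv : ∀ k, v k ∈ E := fun k => Submodule.subset_span ⟨k, rfl⟩
  have : FiniteDimensional ℝ E := FiniteDimensional.span_of_finite ℝ (Set.finite_range v)
  let v' : κ → E := fun k => ⟨v k, hv k⟩
  -- The tensor read as the self-adjoint operator `x ↦ ∑ cₖ ⟨vₖ, x⟩ vₖ` on the finite-dimensional
  -- span of the `vₖ`.
  let A : E →ₗ[ℝ] E := ∑ k, c k • (innerₗ E (v' k)).smulRight (v' k)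
  have hA : ∀ x, A x = ∑ k, c k • (⟪v' k, x⟫_ℝ • v' k) := fun x => by
    simp [A, LinearMap.sum_apply]
  have hAA : ∀ x y, ⟪y, A x⟫_ℝ = ∑ k, c k * (⟪v' k, x⟫_ℝ * ⟪v' k, y⟫_ℝ) := fun x y => by
    rw [hA, inner_sum]
    refine Finset.sum_congr rfl fun k _ => ?_
    rw [inner_smul_right, inner_smul_right, real_inner_comm y]
  have hsym : A.IsSymmetric := fun x y => by
    rw [real_inner_comm, hAA, hAA]
    exact Finset.sum_congr rfl fun k _ => by ring
  let b := hsym.eigenvectorBasis rfl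
  let l := hsym.eigenvalues rfl
  -- Matrix entries of `A` in its eigenbasis: the vanishing off-diagonal ones give the diagonal
  -- form, the diagonal ones the formula for `l i`, which later bounds the eigenvalues.
  have hAb : ∀ i j, ∑ k, c k * (⟪v' k, b j⟫_ℝ * ⟪v' k, b i⟫_ℝ) = if i = j then l i else 0 := by
    intro i j
    rw [← hAA, hsym.apply_eigenvectorBasis rfl j, inner_smul_right]
    have := orthonormal_iff_ite.1 b.orthonormal i j
    rw [this]
    split_ifs with h
    · rw [h]; simp [l]
    · simp
  refine ⟨_, fun i => (b i : 𝔥), l, ?_, ?_, ?_⟩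
  · exact b.orthonormal.comp_linearIsometry E.subtypeₗᵢ
  · have hexp : ∀ k, v k = ∑ i, ⟪v' k, b i⟫_ℝ • (b i : 𝔥) := fun k => by
      have := congrArg (fun x : E => (x : 𝔥)) (b.sum_repr' (v' k))
      simp only [Submodule.coe_sum, Submodule.coe_smul] at this
      rw [show v k = ((v' k : E) : 𝔥) from rfl, ← this]
      exact Finset.sum_congr rfl fun i _ => by rw [real_inner_comm]
    have h1 : ∀ k, c k • (v k ⊗ₜ[ℝ] v k) =
        ∑ i, ∑ j, (c k * (⟪v' k, b j⟫_ℝ * ⟪v' k, b i⟫_ℝ)) • ((b i : 𝔥) ⊗ₜ[ℝ] (b j : 𝔥)) := by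
      intro k
      conv_lhs => rw [hexp k]
      rw [TensorProduct.sum_tmul, Finset.smul_sum]
      refine Finset.sum_congr rfl fun i _ => ?_
      rw [TensorProduct.tmul_sum, Finset.smul_sum]
      refine Finset.sum_congr rfl fun j _ => ?_
      rw [TensorProduct.smul_tmul_smul, smul_smul]
      congr 1; ring
    simp_rw [h1]
    rw [Finset.sum_comm]
    refine Finset.sum_congr rfl fun i _ => ?_
    rw [Finset.sum_comm]
    simp_rw [← Finset.sum_smul, hAb]
    simp
  · intro i
    have := hAb i i
    rw [if_pos rfl] at this
    rw [← this]
    exact Finset.sum_congr rfl fun k _ => by rw [sq]; rfl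

/-- The contraction `⊗₁` as a bilinear map. -/
noncomputable def contrₗ : 𝔥 ⊗[ℝ] 𝔥 →ₗ[ℝ] 𝔥 ⊗[ℝ] 𝔥 →ₗ[ℝ] 𝔥 ⊗[ℝ] 𝔥 :=
  LinearMap.mk₂ ℝ contr₁
    (fun f f' g => by simp [contr₁, TensorProduct.add_tmul])
    (fun c f g => by simp [contr₁, ← TensorProduct.smul_tmul'])
    (fun f g g' => by simp [contr₁, TensorProduct.tmul_add])
    (fun c f g => by simp [contr₁])

theorem contr₁_eq (f g : 𝔥 ⊗[ℝ] 𝔥) : contr₁ f g = contrₗ f g := rfl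

theorem contrₗ_tmul (a b c d : 𝔥) :
    contrₗ (a ⊗ₜ[ℝ] b) (c ⊗ₜ[ℝ] d) = ⟪a, c⟫_ℝ • (b ⊗ₜ[ℝ] d) := by
  simp [← contr₁_eq, contr₁]

theorem contrₗ_sum_sum {κ κ' : Type*} (s : Finset κ) (t : Finset κ') (v : κ → 𝔥) (w : κ' → 𝔥) :
    contrₗ (∑ i ∈ s, v i ⊗ₜ[ℝ] v i) (∑ j ∈ t, w j ⊗ₜ[ℝ] w j) =
      ∑ i ∈ s, ∑ j ∈ t, ⟪v i, w j⟫_ℝ • (v i ⊗ₜ[ℝ] w j) := by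
  rw [Finset.sum_comm]
  simp [map_sum, LinearMap.sum_apply, contrₗ_tmul]

theorem comm_contrₗ_sum_sum {κ κ' : Type*} (s : Finset κ) (t : Finset κ') (v : κ → 𝔥)
    (w : κ' → 𝔥) :
    TensorProduct.comm ℝ 𝔥 𝔥 (contrₗ (∑ i ∈ s, v i ⊗ₜ[ℝ] v i) (∑ j ∈ t, w j ⊗ₜ[ℝ] w j)) =
      contrₗ (∑ j ∈ t, w j ⊗ₜ[ℝ] w j) (∑ i ∈ s, v i ⊗ₜ[ℝ] v i) := by
  rw [contrₗ_sum_sum, contrₗ_sum_sum, Finset.sum_comm]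
  simp only [map_sum, map_smul, TensorProduct.comm_tmul, real_inner_comm]

/-- On a common orthonormal system `⊗₁` is composition of diagonal operators. Thus contracting a
tensor with itself squares its eigenvalues. -/
theorem contrₗ_orthonormal {d : ℕ} {e : Fin d → 𝔥} (he : Orthonormal ℝ e) (a b : Fin d → ℝ) :
    contrₗ (∑ i, a i • (e i ⊗ₜ[ℝ] e i)) (∑ i, b i • (e i ⊗ₜ[ℝ] e i)) =
      ∑ i, (a i * b i) • (e i ⊗ₜ[ℝ] e i) := by
  simp [map_sum, LinearMap.sum_apply, contrₗ_tmul, orthonormal_iff_ite.1 he, smul_smul, mul_comm]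

theorem inner_smul_left_tensor (c : ℝ) (f g : 𝔥 ⊗[ℝ] 𝔥) : ⟪c • f, g⟫_ℝ = c * ⟪f, g⟫_ℝ :=
  real_inner_smul_left (F := 𝔥 ⊗[ℝ] 𝔥) f g c

theorem inner_smul_right_tensor (c : ℝ) (f g : 𝔥 ⊗[ℝ] 𝔥) : ⟪f, c • g⟫_ℝ = c * ⟪f, g⟫_ℝ :=
  real_inner_smul_right (F := 𝔥 ⊗[ℝ] 𝔥) f g c

theorem inner_orthonormal_sum_tmul {d : ℕ} {e : Fin d → 𝔥} (he : Orthonormal ℝ e)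
    (a b : Fin d → ℝ) :
    ⟪∑ i, a i • (e i ⊗ₜ[ℝ] e i), ∑ i, b i • (e i ⊗ₜ[ℝ] e i)⟫_ℝ = ∑ i, a i * b i := by
  simp [sum_inner, inner_sum, inner_smul_left_tensor, inner_smul_right_tensor,
    orthonormal_iff_ite.1 he, mul_comm]

end Tensor

/-! ### Double Wiener integrals and their central limit theorem. -/

section Chaos

variable {𝔥 Ω : Type*} [NormedAddCommGroup 𝔥] [InnerProductSpace ℝ 𝔥] {mΩ : MeasurableSpace Ω}
  {P : Measure Ω} {W : 𝔥 → Ω → ℝ}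

theorem IsIsonormal.I₂_tmul_ae (hW : IsIsonormal W P) (g h : 𝔥) :
    hW.I₂ (g ⊗ₜ[ℝ] h) =ᵐ[P] fun ω => W g ω * W h ω - ⟪g, h⟫_ℝ := by
  rw [IsIsonormal.I₂, TensorProduct.lift.tmul]
  exact AEEqFun.coeFn_mk _ _

theorem IsIsonormal.I₂_sum_ae (hW : IsIsonormal W P) {κ : Type*} (s : Finset κ) (a : κ → ℝ)
    (v : κ → 𝔥) :
    hW.I₂ (∑ i ∈ s, a i • (v i ⊗ₜ[ℝ] v i)) =ᵐ[P]
      fun ω => ∑ i ∈ s, a i * (W (v i) ω ^ 2 - ‖v i‖ ^ 2) := by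
  classical
  induction s using Finset.induction_on with
  | empty =>
    rw [Finset.sum_empty, map_zero]
    simpa using! AEEqFun.coeFn_zero (μ := P) (β := ℝ)
  | insert i s hi ih =>
    rw [Finset.sum_insert hi, map_add, map_smul]
    filter_upwards [AEEqFun.coeFn_add (a i • hW.I₂ (v i ⊗ₜ[ℝ] v i))
      (hW.I₂ (∑ i ∈ s, a i • (v i ⊗ₜ[ℝ] v i))), AEEqFun.coeFn_smul (a i) (hW.I₂ (v i ⊗ₜ[ℝ] v i)),
      ih, hW.I₂_tmul_ae (v i) (v i)] with ω h1 h2 h3 h4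
    rw [h1, Pi.add_apply, h2, Pi.smul_apply, h3, h4, Finset.sum_insert hi,
      real_inner_self_eq_norm_sq, smul_eq_mul]
    ring

/-- A central limit theorem for the pairs `(I₂(A), 2 √n I₂(A ⊗₁ A))`. -/
theorem IsIsonormal.tendstoInDistribution [IsProbabilityMeasure P] (hW : IsIsonormal W P)
    {κ : Type*} (s : ℕ → Finset κ) (c : ℕ → κ → ℝ) (v : ℕ → κ → 𝔥) (A : ℕ → 𝔥 ⊗[ℝ] 𝔥)
    (hA : ∀ n, A n = ∑ k ∈ s n, c n k • (v n k ⊗ₜ[ℝ] v n k)) {a₂ a₃ a₄ : ℝ}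
    (h2 : Tendsto (fun n => ⟪A n, A n⟫_ℝ) atTop (𝓝 a₂))
    (h3 : Tendsto (fun n : ℕ => √(n : ℝ) * ⟪A n, contrₗ (A n) (A n)⟫_ℝ) atTop (𝓝 a₃))
    (h4 : Tendsto (fun n : ℕ => (n : ℝ) * ⟪contrₗ (A n) (A n), contrₗ (A n) (A n)⟫_ℝ) atTop
      (𝓝 a₄))
    {K : ℝ} (hK : ∀ᶠ n : ℕ in atTop, ∀ e : 𝔥, ‖e‖ = 1 →
      √(n : ℝ) * |∑ k ∈ s n, c n k * ⟪v n k, e⟫_ℝ ^ 2| ≤ K)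
    {X Y : ℕ → Ω → ℝ} (hXm : ∀ n, AEMeasurable (X n) P) (hYm : ∀ n, AEMeasurable (Y n) P)
    (hX : ∀ᶠ n in atTop, X n =ᵐ[P] hW.I₂ (A n))
    (hY : ∀ᶠ n : ℕ in atTop, Y n =ᵐ[P] hW.I₂ ((2 * √(n : ℝ)) • contrₗ (A n) (A n)))
    {S : Matrix (Fin 2) (Fin 2) ℝ} (hS : S = !![2 * a₂, 4 * a₃; 4 * a₃, 8 * a₄]) :
    S.PosSemidef ∧ TendstoInDistribution
      (fun (n : ℕ) (ω : Ω) => (!₂[X n ω, Y n ω] : EuclideanSpace ℝ (Fin 2)))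
      atTop id (fun _ => P) (multivariateGaussian 0 S) := by
  have hex : ∀ n, ∃ (d : ℕ) (e : Fin d → 𝔥) (l : Fin d → ℝ), Orthonormal ℝ e ∧
      A n = ∑ i, l i • (e i ⊗ₜ[ℝ] e i) ∧
      ∀ i, l i = ∑ k ∈ s n, c n k * ⟪v n k, e i⟫_ℝ ^ 2 := fun n => by
    obtain ⟨d, e, l, he, h, hl⟩ :=
      exists_orthonormal_sum_tmul (fun k : s n => c n k) (fun k : s n => v n k)
    refine ⟨d, e, l, he, ?_, fun i => ?_⟩
    · rw [← h, hA, Finset.sum_coe_sort (s n) (fun k => c n k • (v n k ⊗ₜ[ℝ] v n k))]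
    · rw [hl, Finset.sum_coe_sort (s n) (fun k => c n k * ⟪v n k, e i⟫_ℝ ^ 2)]
  choose d e l he hAe hl using hex
  have hAA : ∀ n, contrₗ (A n) (A n) = ∑ i, (l n i ^ 2) • (e n i ⊗ₜ[ℝ] e n i) := fun n => by
    rw [hAe, contrₗ_orthonormal (he n)]
    simp_rw [← sq]
  have e2 : ∀ n, ⟪A n, A n⟫_ℝ = ∑ i, l n i ^ 2 := fun n => by
    rw [hAe, inner_orthonormal_sum_tmul (he n)]
    simp_rw [← sq]
  have e3 : ∀ n, ⟪A n, contrₗ (A n) (A n)⟫_ℝ = ∑ i, l n i ^ 3 := fun n => by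
    rw [hAA, hAe, inner_orthonormal_sum_tmul (he n)]
    exact Finset.sum_congr rfl fun i _ => by ring
  have e4 : ∀ n, ⟪contrₗ (A n) (A n), contrₗ (A n) (A n)⟫_ℝ = ∑ i, l n i ^ 4 := fun n => by
    rw [hAA, inner_orthonormal_sum_tmul (he n)]
    exact Finset.sum_congr rfl fun i _ => by ring
  simp_rw [e2] at h2
  simp_rw [e3] at h3
  simp_rw [e4] at h4
  -- The weights of `ξᵢ² - 1` in `t₀ X + t₁ Y`.
  let μ : EuclideanSpace ℝ (Fin 2) → ∀ n, Fin (d n) → ℝ :=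
    fun t n i => t 0 * l n i + t 1 * (2 * √(n : ℝ) * l n i ^ 2)
  have hsum : ∀ t : EuclideanSpace ℝ (Fin 2), Tendsto (fun n => ∑ i, μ t n i ^ 2) atTop
      (𝓝 (t 0 ^ 2 * a₂ + 4 * t 0 * t 1 * a₃ + 4 * t 1 ^ 2 * a₄)) := fun t => by
    have := ((h2.const_mul (t 0 ^ 2)).add (h3.const_mul (4 * t 0 * t 1))).add
      (h4.const_mul (4 * t 1 ^ 2))
    refine this.congr fun n => ?_
    simp only [Finset.mul_sum, ← Finset.sum_add_distrib, μ]
    refine Finset.sum_congr rfl fun i _ => ?_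
    have hn : √(n : ℝ) ^ 2 = n := Real.sq_sqrt (Nat.cast_nonneg n)
    linear_combination (-4 * t 1 ^ 2 * l n i ^ 4) * hn
  have hquad : ∀ t : EuclideanSpace ℝ (Fin 2), t 0 ^ 2 * a₂ + 4 * t 0 * t 1 * a₃ + 4 * t 1 ^ 2 * a₄ =
      (t 0 * (2 * a₂ * t 0 + 4 * a₃ * t 1) + t 1 * (4 * a₃ * t 0 + 8 * a₄ * t 1)) / 2 :=
    fun t => by ring
  -- The quadratic form of `S` is twice the limit of `∑ μᵢ²`; the factor 2 is the variance of `ξ² -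
  -- 1`.
  have hpos : S.PosSemidef := by
    refine Matrix.PosSemidef.of_dotProduct_mulVec_nonneg ?_ fun x => ?_
    · rw [hS]
      ext i j
      fin_cases i <;> fin_cases j <;> simp
    · have h0 := ge_of_tendsto' (b := 0) (hsum (WithLp.toLp 2 x)) fun n =>
        Finset.sum_nonneg fun i _ => sq_nonneg _
      rw [hquad] at h0
      rw [hS]
      simp [Matrix.mulVec, dotProduct, Fin.sum_univ_two] at h0 ⊢
      linarith
  refine ⟨hpos, ?_⟩
  have hm : ∀ n, AEMeasurable (fun ω => (!₂[X n ω, Y n ω] : EuclideanSpace ℝ (Fin 2))) P :=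
      fun n => by
    have : AEMeasurable (fun ω => ![X n ω, Y n ω]) P := by
      refine aemeasurable_pi_iff.2 fun k => ?_
      fin_cases k
      · simpa using hXm n
      · simpa using hYm n
    exact (PiLp.continuous_toLp 2 _).measurable.comp_aemeasurable this
  refine ⟨hm, by fun_prop, ?_⟩
  refine ProbabilityMeasure.tendsto_of_tendsto_charFun (E := EuclideanSpace ℝ (Fin 2)) fun t => ?_
  simp only [ProbabilityMeasure.coe_mk, Measure.map_id]
  rw [charFun_multivariateGaussian hpos]
  have hlim : Tendsto (fun n => ∏ i, charFun chiLaw (μ t n i)) atTop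
      (𝓝 (Complex.exp (-(t 0 ^ 2 * a₂ + 4 * t 0 * t 1 * a₃ + 4 * t 1 ^ 2 * a₄ : ℝ)))) := by
    -- From `√n |lᵢ| ≤ K` one gets `√n |μᵢ| ≤ |t₀| K + 2 |t₁| K²`, so the largest weight vanishes in
    -- the limit.
    refine tendsto_prod_charFun_chiLaw (μ t)
      (r := fun n : ℕ => (|t 0| * K + 2 * |t 1| * K ^ 2) / √(n : ℝ)) ?_ ?_ (hsum t)
    · exact tendsto_const_nhds.div_atTop
        (Real.tendsto_sqrt_atTop.comp tendsto_natCast_atTop_atTop)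
    · filter_upwards [hK, eventually_gt_atTop 0] with n hn hn0 i
      have hli := hn (e n i) ((he n).1 i)
      rw [← hl] at hli
      have hn1 : 0 < √(n : ℝ) := Real.sqrt_pos.2 (Nat.cast_pos.2 hn0)
      rw [le_div_iff₀ hn1]
      have : |μ t n i| ≤ |t 0| * |l n i| + |t 1| * (2 * √(n : ℝ) * |l n i| ^ 2) := by
        refine (abs_add_le _ _).trans (le_of_eq ?_)
        rw [abs_mul, abs_mul, abs_mul, abs_mul, abs_pow, abs_of_pos hn1, abs_two]
      calc |μ t n i| * √(n : ℝ)
          ≤ (|t 0| * |l n i| + |t 1| * (2 * √(n : ℝ) * |l n i| ^ 2)) * √(n : ℝ) := by gcongr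
        _ = |t 0| * (√(n : ℝ) * |l n i|) + 2 * |t 1| * (√(n : ℝ) * |l n i|) ^ 2 := by ring
        _ ≤ _ := by gcongr
  have hval : Complex.exp (-(t 0 ^ 2 * a₂ + 4 * t 0 * t 1 * a₃ + 4 * t 1 ^ 2 * a₄ : ℝ)) =
      Complex.exp (⟪t, (0 : EuclideanSpace ℝ (Fin 2))⟫_ℝ * Complex.I -
        ((t.ofLp ⬝ᵥ S.mulVec t.ofLp : ℝ) : ℂ) / 2) := by
    rw [hquad, hS]
    congr 1
    simp [Matrix.mulVec, dotProduct, Fin.sum_univ_two]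
  rw [hval] at hlim
  refine hlim.congr' ?_
  filter_upwards [hX, hY] with n hXn hYn
  rw [← hW.charFun_pair (he n) (l n) (fun i => 2 * √(n : ℝ) * l n i ^ 2)]
  congr 1
  refine Measure.map_congr ?_
  rw [hAe] at hXn
  rw [hAA, Finset.smul_sum] at hYn
  simp_rw [smul_smul] at hYn
  filter_upwards [hXn, hYn, hW.I₂_sum_ae Finset.univ (l n) (e n),
    hW.I₂_sum_ae Finset.univ (fun i => 2 * √(n : ℝ) * l n i ^ 2) (e n)] with ω g1 g2 g3 g4
  simp only [(he n).1, one_pow] at g3 g4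
  rw [g1, g2, g3, g4]

end Chaos

/-! ### Decay of `ρ̂` and `ρ̃`, and absolute convergence of the series. -/

section Correlation

theorem hasDerivAt_iterate_fwdDiff_rpow (k : ℕ) (p : ℝ) {x : ℝ} (hx : 0 < x) :
    HasDerivAt ((fwdDiff 1)^[k] fun y : ℝ => y ^ p)
      (p * (fwdDiff 1)^[k] (fun y : ℝ => y ^ (p - 1)) x) x := by
  induction k generalizing x with
  | zero => simpa using Real.hasDerivAt_rpow_const (p := p) (Or.inl hx.ne')
  | succ k ih =>
    rw [Function.iterate_succ_apply', Function.iterate_succ_apply']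
    have h1 := (ih (x := x + 1) (by linarith)).comp_add_const x 1
    refine (h1.sub (ih hx)).congr_deriv ?_
    rw [fwdDiff]; ring

/-- Iterated differences of a power function decay as the derivatives do. -/
theorem exists_iterate_fwdDiff_rpow_le (k : ℕ) (p : ℝ) (hp : p ≤ k) :
    ∃ C, 0 ≤ C ∧ ∀ x : ℝ, 1 ≤ x →
      |(fwdDiff 1)^[k] (fun y : ℝ => y ^ p) x| ≤ C * x ^ (p - k) := by
  induction k generalizing p with
  | zero =>
    refine ⟨1, zero_le_one, fun x hx => ?_⟩
    simp [abs_of_nonneg (Real.rpow_nonneg (zero_le_one.trans hx) p)]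
  | succ k ih =>
    push_cast at hp
    obtain ⟨C, hC, h⟩ := ih (p - 1) (by linarith)
    refine ⟨|p| * C, by positivity, fun x hx => ?_⟩
    have hx0 : 0 < x := by linarith
    -- The mean value theorem trades one difference for one derivative, which lowers the exponent by
    -- one. The bound at `ξ > x` passes to `x` because the exponent `p - 1 - k` is nonpositive.
    obtain ⟨ξ, hξ, he⟩ := exists_hasDerivAt_eq_slope ((fwdDiff 1)^[k] fun y : ℝ => y ^ p)
      (fun y => p * (fwdDiff 1)^[k] (fun y : ℝ => y ^ (p - 1)) y) (lt_add_one x)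
      (fun y hy => (hasDerivAt_iterate_fwdDiff_rpow k p
        (hx0.trans_le hy.1)).continuousAt.continuousWithinAt)
      (fun y hy => hasDerivAt_iterate_fwdDiff_rpow k p (hx0.trans hy.1))
    rw [add_sub_cancel_left, div_one] at he
    rw [Function.iterate_succ_apply', fwdDiff, ← he, abs_mul, mul_assoc]
    refine mul_le_mul_of_nonneg_left ((h ξ (hx.trans hξ.1.le)).trans ?_) (abs_nonneg _)
    refine mul_le_mul_of_nonneg_left ?_ hC
    rw [show p - ((k + 1 : ℕ) : ℝ) = p - 1 - k by push_cast; ring]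
    exact Real.rpow_le_rpow_of_nonpos hx0 hξ.1.le (by linarith)

theorem rhoHat_neg (H : ℝ) (j : ℤ) : rhoHat H (-j) = rhoHat H j := by
  have h : ∀ x y : ℝ, |-x - y| = |x + y| := fun x y => by
    rw [← abs_neg]; congr 1; ring
  have h' : ∀ x y : ℝ, |-x + y| = |x - y| := fun x y => by
    rw [← abs_neg]; congr 1; ring
  simp only [rhoHat, Int.cast_neg, h, h', abs_neg]
  ring

theorem rhoHat_sub_comm (H : ℝ) (i j : ℤ) : rhoHat H (i - j) = rhoHat H (j - i) := by
  rw [← rhoHat_neg, neg_sub]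

theorem rhoHat_zero {H : ℝ} (h0 : 0 < H) : rhoHat H 0 = cH H := by
  simp [rhoHat, cH, Real.zero_rpow (by positivity : 2 * H ≠ 0)]
  ring

/-- `ρ̂` is minus half the fourth central difference of `|x|^{2H}`. The shift by three keeps the
five points in `[1, ∞)`, where the decay estimate applies. -/
theorem rhoHat_add_three (H : ℝ) (n : ℕ) :
    rhoHat H ((n + 3 : ℕ) : ℤ) =
      -(1 / 2) * (fwdDiff 1)^[4] (fun y : ℝ => y ^ (2 * H)) (n + 1) := by
  have hn : (0 : ℝ) ≤ n := Nat.cast_nonneg n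
  simp only [Function.iterate_succ, Function.iterate_zero, Function.comp_apply, id, fwdDiff,
    rhoHat]
  push_cast
  rw [abs_of_nonneg (by linarith : (0 : ℝ) ≤ n + 3 - 2),
    abs_of_nonneg (by linarith : (0 : ℝ) ≤ n + 3 - 1),
    abs_of_nonneg (by linarith : (0 : ℝ) ≤ (n : ℝ) + 3),
    abs_of_nonneg (by linarith : (0 : ℝ) ≤ n + 3 + 1),
    abs_of_nonneg (by linarith : (0 : ℝ) ≤ n + 3 + 2)]
  ring_nf

theorem summable_rhoHat {H : ℝ} (h1 : H < 1) : Summable (rhoHat H) := by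
  have hnat : Summable fun n : ℕ => rhoHat H (n : ℤ) := by
    rw [← summable_nat_add_iff 3]
    obtain ⟨C, hC, h⟩ := exists_iterate_fwdDiff_rpow_le 4 (2 * H) (by push_cast; linarith)
    have hs : Summable fun n : ℕ => C * ((n : ℝ) + 1) ^ (2 * H - 4) := by
      refine Summable.mul_left C ?_
      have := (summable_nat_add_iff 1).2 (Real.summable_nat_rpow (p := 2 * H - 4)|>.2 (by linarith))
      simpa using this
    refine Summable.of_norm_bounded hs fun n => ?_
    rw [rhoHat_add_three, Real.norm_eq_abs, abs_mul]
    have := h (n + 1) (by linarith [Nat.cast_nonneg (α := ℝ) n])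
    push_cast at this
    have h2 : |(-(1 / 2) : ℝ)| ≤ 1 := by norm_num
    exact (mul_le_of_le_one_left (abs_nonneg _) h2).trans this
  exact Summable.of_nat_of_neg hnat (by simpa [rhoHat_neg] using hnat)

/-- This mirrors the splitting of a coarse second difference into fine ones with weights 1, 2, 1
(`stepDiff_eq`); symmetry and summability of `ρ̃` are inherited through it. -/
theorem rhoTilde_eq {H : ℝ} (j : ℤ) :
    rhoTilde H j =
      1 / 2 ^ (2 * H) * (rhoHat H (j + 1) + 2 * rhoHat H j + rhoHat H (j - 1)) := by
  rw [rhoTilde, Real.rpow_add two_pos, Real.rpow_one]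
  simp only [rhoHat]
  push_cast
  have hp : (0 : ℝ) < 2 ^ (2 * H) := by positivity
  rw [show (j : ℝ) + 1 - 2 = j - 1 by ring, show (j : ℝ) + 1 - 1 = j by ring,
    show (j : ℝ) + 1 + 1 = j + 2 by ring, show (j : ℝ) + 1 + 2 = j + 3 by ring,
    show (j : ℝ) - 1 - 2 = j - 3 by ring, show (j : ℝ) - 1 - 1 = j - 2 by ring,
    show (j : ℝ) - 1 + 1 = j by ring, show (j : ℝ) - 1 + 2 = j + 1 by ring]
  field_simp
  ring

theorem rhoTilde_neg (H : ℝ) (j : ℤ) : rhoTilde H (-j) = rhoTilde H j := by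
  rw [rhoTilde_eq, rhoTilde_eq, rhoHat_neg, show -j + 1 = -(j - 1) by ring,
    show -j - 1 = -(j + 1) by ring, rhoHat_neg, rhoHat_neg]
  ring

theorem rhoTilde_sub_comm (H : ℝ) (i j : ℤ) : rhoTilde H (i - j) = rhoTilde H (j - i) := by
  rw [← rhoTilde_neg, neg_sub]

theorem summable_rhoTilde {H : ℝ} (h1 : H < 1) : Summable (rhoTilde H) := by
  have h := summable_rhoHat h1
  have := ((h.comp_injective (add_left_injective 1)).add (h.mul_left 2)).add
    (h.comp_injective (sub_left_injective (b := (1 : ℤ))))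
  exact (this.mul_left (1 / 2 ^ (2 * H))).congr fun j => (rhoTilde_eq j).symm

/-- A cycle has one factor more than it has free indices. The factors read through the injection `φ`
have a summable product, and the last factor is merely bounded by its `ℓ¹` norm. -/
theorem summable_mul_comp_of_injective₂ {ι α β δ : Type*} {f : α → ℝ} {g : β → ℝ}
    {k : δ → ℝ} (hf : Summable f) (hg : Summable g) (hk : Summable k)
    (φ : ι → α × β) (hφ : Function.Injective φ) (ψ : ι → δ) :
    Summable fun i => f (φ i).1 * g (φ i).2 * k (ψ i) := by
  have h2 : Summable fun p : α × β => ‖f p.1 * g p.2‖ := hf.norm.mul_norm hg.norm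
  refine Summable.of_norm_bounded ((h2.comp_injective hφ).mul_right (∑' d, ‖k d‖)) fun i => ?_
  rw [norm_mul, Function.comp_apply]
  exact mul_le_mul_of_nonneg_left (hk.norm.le_tsum _ fun _ _ => norm_nonneg _) (norm_nonneg _)

theorem summable_mul_comp_of_injective {ι α β γ δ : Type*} {f : α → ℝ} {g : β → ℝ} {h : γ → ℝ}
    {k : δ → ℝ} (hf : Summable f) (hg : Summable g) (hh : Summable h) (hk : Summable k)
    (φ : ι → α × β × γ) (hφ : Function.Injective φ) (ψ : ι → δ) :
    Summable fun i => f (φ i).1 * g (φ i).2.1 * h (φ i).2.2 * k (ψ i) := by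
  have h2 : Summable fun p : β × γ => g p.1 * h p.2 := summable_mul_of_summable_norm hg.norm hh.norm
  simpa only [mul_assoc] using summable_mul_comp_of_injective₂ hf h2 hk φ hφ ψ

theorem summable_sq_of_summable {α : Type*} {f : α → ℝ} (hf : Summable f) :
    Summable fun i => f i ^ 2 := by
  refine Summable.of_norm_bounded (hf.norm.mul_right (∑' d, ‖f d‖)) fun i => ?_
  rw [sq, norm_mul]
  exact mul_le_mul_of_nonneg_left (hf.norm.le_tsum _ fun _ _ => norm_nonneg _) (norm_nonneg _)

theorem summable_term11_22_even {H : ℝ} (h1 : H < 1) : Summable fun i : ℤ × ℤ × ℤ =>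
    rhoTilde H (2 * i.1) * rhoHat H (i.1 - i.2.1) * rhoTilde H (2 * i.2.1 - i.2.2)
      * rhoHat H i.2.2 :=
  summable_mul_comp_of_injective (summable_rhoTilde h1) (summable_rhoHat h1)
    (summable_rhoTilde h1) (summable_rhoHat h1)
    (fun i : ℤ × ℤ × ℤ => (2 * i.1, i.1 - i.2.1, 2 * i.2.1 - i.2.2))
    (fun i j h => by grind) fun i => i.2.2

theorem summable_term11_22_odd {H : ℝ} (h1 : H < 1) : Summable fun i : ℤ × ℤ × ℤ =>
    rhoTilde H (2 * i.1 + 1) * rhoHat H (i.1 - i.2.1) * rhoTilde H (2 * i.2.1 - i.2.2 + 1)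
      * rhoHat H i.2.2 :=
  summable_mul_comp_of_injective (summable_rhoTilde h1) (summable_rhoHat h1)
    (summable_rhoTilde h1) (summable_rhoHat h1)
    (fun i : ℤ × ℤ × ℤ => (2 * i.1 + 1, i.1 - i.2.1, 2 * i.2.1 - i.2.2 + 1))
    (fun i j h => by grind) fun i => i.2.2

theorem seriesConverge {H : ℝ} (h1 : H < 1) : SeriesConverge H := by
  have r := summable_rhoHat h1
  have s := summable_rhoTilde h1
  refine ⟨?_, summable_sq_of_summable s, ?_, ?_, ?_, ?_, ?_, ?_, ?_, ?_, ?_, ?_⟩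
  · exact (summable_sq_of_summable r).comp_injective (i := fun k : ℕ => (k : ℤ) + 1)
      fun i j h => by simpa using h
  · exact (summable_mul_comp_of_injective₂ r r r (fun i : ℤ × ℤ => (i.1, i.1 - i.2))
      (fun i j h => by grind) fun i => i.2)
  · exact (summable_mul_comp_of_injective₂ r s s (fun i : ℤ × ℤ => (i.1, i.2 - 2 * i.1))
      (fun i j h => by grind) fun i => i.2)
  · exact (summable_mul_comp_of_injective₂ r s s (fun i : ℤ × ℤ => (i.1, i.1 - i.2))
      (fun i j h => by grind) fun i => i.2)
  · exact summable_mul_comp_of_injective r r r r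
      (fun i : ℤ × ℤ × ℤ => (i.1, i.1 - i.2.1, i.2.1 - i.2.2)) (fun i j h => by grind)
      fun i => i.2.2
  · exact (summable_term11_22_even h1).add (summable_term11_22_odd h1)
  · exact summable_mul_comp_of_injective r s s r
      (fun i : ℤ × ℤ × ℤ => (i.1, 2 * i.1 - i.2.1, i.2.1 - 2 * i.2.2)) (fun i j h => by grind)
      fun i => i.2.2
  · exact summable_mul_comp_of_injective r r s s
      (fun i : ℤ × ℤ × ℤ => (i.1, i.1 - i.2.1, i.2.1 - i.2.2)) (fun i j h => by grind)
      fun i => i.2.2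
  · exact summable_mul_comp_of_injective r s r s
      (fun i : ℤ × ℤ × ℤ => (i.1, 2 * i.1 - i.2.1, i.2.1 - i.2.2)) (fun i j h => by grind)
      fun i => i.2.2
  · exact summable_mul_comp_of_injective s s s s
      (fun i : ℤ × ℤ × ℤ => (2 * i.1, 2 * i.1 - i.2.1, i.2.1 - 2 * i.2.2)) (fun i j h => by grind)
      fun i => 2 * i.2.2
  · exact summable_mul_comp_of_injective s s s s
      (fun i : ℤ × ℤ × ℤ => (2 * i.1 + 1, 2 * i.1 - i.2.1, i.2.1 - 2 * i.2.2))
      (fun i j h => by grind) fun i => 2 * i.2.2 + 1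

end Correlation

/-! ### Averages of translates of a summable kernel. -/

section Average

/-- Averages over growing windows of the translates of a summable function. -/
theorem tendsto_average_translates {X Y : Type*} {K : Y → ℝ} (hK : Summable K)
    {B : ℕ → Finset ℕ} (S : ℕ → Finset X) (ψ : ℕ → X → Y) (hB : ∀ n, (B n).card ≤ n)
    (hψ : ∀ b, Function.Injective (ψ b))
    (hcov : ∀ y, ∃ m, ∀ n b, m ≤ b → b + m ≤ n → b ∈ B n ∧ ∃ x ∈ S n, ψ b x = y) :
    Tendsto (fun n : ℕ => (n : ℝ)⁻¹ * ∑ b ∈ B n, ∑ x ∈ S n, K (ψ b x)) atTop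
      (𝓝 (∑' y, K y)) := by
  classical
  -- The number of base points `b` from which `y` is reached, divided by `n`. As `ψ b` is injective,
  -- each `b` meets `y` at most once, so the average equals `∑ a n y * K y`; the weights are at most
  -- 1 and tend to 1, and dominated convergence applies.
  let a : ℕ → Y → ℝ := fun n y =>
    (n : ℝ)⁻¹ * ((B n).filter fun b => y ∈ (S n).image (ψ b)).card
  have hle : ∀ n y, a n y ≤ 1 := fun n y => by
    have h1 : (((B n).filter fun b => y ∈ (S n).image (ψ b)).card : ℝ) ≤ n := by
      exact_mod_cast (Finset.card_filter_le _ _).trans (hB n)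
    rcases Nat.eq_zero_or_pos n with rfl | hn
    · simp [a]
    · have hn' : (0 : ℝ) < n := Nat.cast_pos.2 hn
      simp only [a]
      rw [inv_mul_le_iff₀ hn', mul_one]
      exact h1
  have h0 : ∀ n y, 0 ≤ a n y := fun n y => by positivity
  have hlim : ∀ y, Tendsto (fun n => a n y) atTop (𝓝 1) := fun y => by
    obtain ⟨m, hm⟩ := hcov y
    have hl : Tendsto (fun n : ℕ => 1 - 2 * (m : ℝ) / n) atTop (𝓝 1) := by
      have := (tendsto_const_div_atTop_nhds_zero_nat (2 * (m : ℝ))).const_sub 1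
      simpa using this
    refine tendsto_of_tendsto_of_tendsto_of_le_of_le' hl tendsto_const_nhds ?_
      (Eventually.of_forall fun n => hle n y)
    filter_upwards [eventually_ge_atTop (2 * m + 1)] with n hn
    have hn' : (0 : ℝ) < n := Nat.cast_pos.2 (by omega)
    -- Only base points closer than `m` to an end can miss `y`, a loss of at most `2m/n`.
    have hsub : Finset.Icc m (n - m) ⊆ (B n).filter fun b => y ∈ (S n).image (ψ b) := by
      intro b hb
      rw [Finset.mem_Icc] at hb
      obtain ⟨hb1, hb2⟩ := hm n b hb.1 (by omega)
      exact Finset.mem_filter.2 ⟨hb1, Finset.mem_image.2 hb2⟩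
    have hcard := Finset.card_le_card hsub
    rw [Nat.card_Icc] at hcard
    have hc : (n : ℝ) - 2 * m ≤ ((B n).filter fun b => y ∈ (S n).image (ψ b)).card := by
      have : n ≤ ((B n).filter fun b => y ∈ (S n).image (ψ b)).card + 2 * m := by omega
      have : (n : ℝ) ≤ ((B n).filter fun b => y ∈ (S n).image (ψ b)).card + 2 * m := by
        exact_mod_cast this
      linarith
    simp only [a]
    rw [le_inv_mul_iff₀ hn']
    refine le_trans (le_of_eq ?_) hc
    field_simp
  have hrep : ∀ n : ℕ, (n : ℝ)⁻¹ * ∑ b ∈ B n, ∑ x ∈ S n, K (ψ b x) = ∑' y, a n y * K y := by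
    intro n
    have e1 : ∀ b, ∑ x ∈ S n, K (ψ b x) =
        ∑' y, Set.indicator (((S n).image (ψ b) : Finset Y) : Set Y) K y := fun b => by
      rw [← sum_eq_tsum_indicator, Finset.sum_image fun x _ x' _ h => hψ b h]
    simp_rw [e1]
    rw [← Summable.tsum_finsetSum fun b _ => hK.indicator _, ← tsum_mul_left]
    refine tsum_congr fun y => ?_
    simp only [a, Set.indicator_apply, Finset.mem_coe]
    rw [← Finset.sum_filter, Finset.sum_const, nsmul_eq_mul, mul_assoc]
  simp_rw [hrep]
  refine tendsto_tsum_of_dominated_convergence hK.norm (fun y => ?_)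
    (Eventually.of_forall fun n y => ?_)
  · simpa using (hlim y).mul_const (K y)
  · rw [norm_mul, Real.norm_of_nonneg (h0 n y)]
    exact mul_le_of_le_one_left (norm_nonneg _) (hle n y)

end Average

/-! ### Cyclic sums of inner products, and a Schur test. -/

section Cycles

variable {𝔥 : Type*} [NormedAddCommGroup 𝔥] [InnerProductSpace ℝ 𝔥]

/-- A finite family of vectors, indexed by a finite set of natural numbers. -/
structure Family (𝔥 : Type*) where
  /-- the index set -/
  idx : Finset ℕ
  /-- the vectors -/
  vec : ℕ → 𝔥

namespace Family

/-- The tensor `∑ v ⊗ v` of a family. -/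
noncomputable def diag (A : Family 𝔥) : 𝔥 ⊗[ℝ] 𝔥 := ∑ i ∈ A.idx, A.vec i ⊗ₜ[ℝ] A.vec i

/-- The sum of the products of inner products along cycles of length two. -/
noncomputable def cyc2 (A B : Family 𝔥) : ℝ :=
  ∑ i ∈ A.idx, ∑ j ∈ B.idx, ⟪A.vec i, B.vec j⟫_ℝ * ⟪B.vec j, A.vec i⟫_ℝ

/-- The sum of the products of inner products along cycles of length three. -/
noncomputable def cyc3 (A B C : Family 𝔥) : ℝ :=
  ∑ i ∈ A.idx, ∑ j ∈ B.idx, ∑ k ∈ C.idx,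
    ⟪A.vec i, B.vec j⟫_ℝ * ⟪B.vec j, C.vec k⟫_ℝ * ⟪C.vec k, A.vec i⟫_ℝ

/-- The sum of the products of inner products along cycles of length four. -/
noncomputable def cyc4 (A B C D : Family 𝔥) : ℝ :=
  ∑ i ∈ A.idx, ∑ j ∈ B.idx, ∑ k ∈ C.idx, ∑ l ∈ D.idx,
    ⟪A.vec i, B.vec j⟫_ℝ * ⟪B.vec j, C.vec k⟫_ℝ * ⟪C.vec k, D.vec l⟫_ℝ * ⟪D.vec l, A.vec i⟫_ℝ

theorem cyc3_rotate (A B C : Family 𝔥) : cyc3 A B C = cyc3 B C A := by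
  rw [cyc3, cyc3, Finset.sum_comm]
  refine Finset.sum_congr rfl fun j _ => ?_
  rw [Finset.sum_comm]
  exact Finset.sum_congr rfl fun k _ => Finset.sum_congr rfl fun i _ => by ring

theorem cyc3_swap (A B C : Family 𝔥) : cyc3 A B C = cyc3 A C B := by
  rw [cyc3, cyc3]
  refine Finset.sum_congr rfl fun j _ => ?_
  rw [Finset.sum_comm]
  refine Finset.sum_congr rfl fun k _ => Finset.sum_congr rfl fun i _ => ?_
  rw [real_inner_comm (B.vec i), real_inner_comm (C.vec k), real_inner_comm (C.vec k)]
  ring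

theorem cyc4_rotate (A B C D : Family 𝔥) : cyc4 A B C D = cyc4 B C D A := by
  rw [cyc4, cyc4, Finset.sum_comm]
  refine Finset.sum_congr rfl fun j _ => ?_
  rw [Finset.sum_comm]
  refine Finset.sum_congr rfl fun k _ => ?_
  rw [Finset.sum_comm]
  exact Finset.sum_congr rfl fun l _ => Finset.sum_congr rfl fun i _ => by ring

theorem inner_diag_diag (A B : Family 𝔥) : ⟪A.diag, B.diag⟫_ℝ = cyc2 A B := by
  rw [diag, diag, sum_inner, cyc2]
  refine Finset.sum_congr rfl fun i _ => ?_
  rw [inner_sum]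
  refine Finset.sum_congr rfl fun j _ => ?_
  rw [TensorProduct.inner_tmul, real_inner_comm (A.vec i) (B.vec j)]

theorem inner_diag_contrₗ (A B C : Family 𝔥) :
    ⟪A.diag, contrₗ B.diag C.diag⟫_ℝ = cyc3 A B C := by
  rw [diag, diag, diag, contrₗ_sum_sum, sum_inner, cyc3]
  refine Finset.sum_congr rfl fun i _ => ?_
  rw [inner_sum]
  refine Finset.sum_congr rfl fun j _ => ?_
  rw [inner_sum]
  refine Finset.sum_congr rfl fun k _ => ?_
  rw [inner_smul_right_tensor, TensorProduct.inner_tmul, real_inner_comm (A.vec i) (C.vec k)]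
  ring

/-- The contractions join `A` to `B` and `C` to `D`; the inner product of tensors joins `A` to `C`
and `B` to `D`. Going round the cycle therefore meets `D` before `C`. -/
theorem inner_contrₗ_contrₗ (A B C D : Family 𝔥) :
    ⟪contrₗ A.diag B.diag, contrₗ C.diag D.diag⟫_ℝ = cyc4 A B D C := by
  rw [diag, diag, diag, diag, contrₗ_sum_sum, contrₗ_sum_sum, sum_inner, cyc4]
  refine Finset.sum_congr rfl fun i _ => ?_
  rw [sum_inner]
  refine Finset.sum_congr rfl fun j _ => ?_
  simp only [inner_sum]
  rw [Finset.sum_comm]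
  refine Finset.sum_congr rfl fun k _ => Finset.sum_congr rfl fun l _ => ?_
  rw [inner_smul_right_tensor, inner_smul_left_tensor, TensorProduct.inner_tmul,
    real_inner_comm (A.vec i) (C.vec l), real_inner_comm (C.vec l) (D.vec k)]
  ring

/-- A bound of Bessel type. -/
theorem sum_inner_sq_le (A : Family 𝔥) {L : ℝ}
    (hA : ∀ i ∈ A.idx, ∑ j ∈ A.idx, |⟪A.vec i, A.vec j⟫_ℝ| ≤ L) (hL : 0 ≤ L) {e : 𝔥} (he : ‖e‖ = 1) :
    ∑ i ∈ A.idx, ⟪A.vec i, e⟫_ℝ ^ 2 ≤ L := by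
  set x : ℕ → ℝ := fun i => ⟪A.vec i, e⟫_ℝ with hx
  set s := ∑ i ∈ A.idx, x i ^ 2 with hs
  have hs0 : 0 ≤ s := Finset.sum_nonneg fun i _ => sq_nonneg _
  set y : 𝔥 := ∑ i ∈ A.idx, x i • A.vec i with hy
  have h1 : s = ⟪y, e⟫_ℝ := by
    rw [hy, sum_inner, hs]
    exact Finset.sum_congr rfl fun i _ => by rw [real_inner_smul_left, sq]
  have h2 : s ≤ ‖y‖ := by
    rw [h1]
    simpa [he] using real_inner_le_norm y e
  -- Schur's test: `2 xᵢ xⱼ ≤ xᵢ² + xⱼ²` and the row sums bound the Gram form by `L`. With `s ≤ ‖y‖`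
  -- this gives `s² ≤ L s`.
  have h3 : ‖y‖ ^ 2 ≤ L * s := by
    have e1 : ‖y‖ ^ 2 = ∑ i ∈ A.idx, ∑ j ∈ A.idx, x i * x j * ⟪A.vec i, A.vec j⟫_ℝ := by
      rw [← real_inner_self_eq_norm_sq, hy, sum_inner]
      refine Finset.sum_congr rfl fun i _ => ?_
      rw [inner_sum]
      refine Finset.sum_congr rfl fun j _ => ?_
      rw [real_inner_smul_left, real_inner_smul_right]; ring
    have e2 : ∀ i j, x i * x j * ⟪A.vec i, A.vec j⟫_ℝ ≤
        x i ^ 2 / 2 * |⟪A.vec i, A.vec j⟫_ℝ| + x j ^ 2 / 2 * |⟪A.vec j, A.vec i⟫_ℝ| := by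
      intro i j
      rw [real_inner_comm (A.vec i) (A.vec j), ← add_mul]
      refine (le_abs_self _).trans ?_
      rw [abs_mul]
      refine mul_le_mul_of_nonneg_right ?_ (abs_nonneg _)
      rw [abs_le]
      constructor <;> nlinarith [sq_nonneg (x i - x j), sq_nonneg (x i + x j)]
    have e3 : ∑ i ∈ A.idx, ∑ j ∈ A.idx, x i ^ 2 / 2 * |⟪A.vec i, A.vec j⟫_ℝ| ≤ L * s / 2 := by
      rw [hs, Finset.mul_sum, Finset.sum_div]
      refine Finset.sum_le_sum fun i hi => ?_
      rw [← Finset.mul_sum]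
      have := mul_le_mul_of_nonneg_left (hA i hi) (by positivity : 0 ≤ x i ^ 2 / 2)
      linarith
    rw [e1]
    calc _ ≤ ∑ i ∈ A.idx, ∑ j ∈ A.idx, (x i ^ 2 / 2 * |⟪A.vec i, A.vec j⟫_ℝ|
          + x j ^ 2 / 2 * |⟪A.vec j, A.vec i⟫_ℝ|) :=
          Finset.sum_le_sum fun i _ => Finset.sum_le_sum fun j _ => e2 i j
      _ = (∑ i ∈ A.idx, ∑ j ∈ A.idx, x i ^ 2 / 2 * |⟪A.vec i, A.vec j⟫_ℝ|) +
          ∑ j ∈ A.idx, ∑ i ∈ A.idx, x j ^ 2 / 2 * |⟪A.vec j, A.vec i⟫_ℝ| := by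
          simp_rw [Finset.sum_add_distrib]
          congr 1
          exact Finset.sum_comm
      _ ≤ L * s / 2 + L * s / 2 := add_le_add e3 e3
      _ = L * s := by ring
  rcases hs0.eq_or_lt with h0 | h0
  · rw [← h0]; exact hL
  · have : s * s ≤ L * s := by nlinarith
    exact le_of_mul_le_mul_right this h0

/-- Here `i` is the base vertex, `ψ i j` encodes the position of the cycle relative to it, and `σ n`
collects the variance scales. Only the base family is limited to `n` members; the others may live on
the finer grid. -/
theorem tendsto_cyc2 {A B : ℕ → Family 𝔥} {K : ℤ → ℝ} (hK : Summable K) (σ : ℕ → ℝ)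
    (ψ : ℕ → ℕ → ℤ) (hB : ∀ n, (A n).idx.card ≤ n)
    (hψ : ∀ b, Function.Injective (ψ b))
    (hcov : ∀ y, ∃ m, ∀ n b, m ≤ b → b + m ≤ n → b ∈ (A n).idx ∧ ∃ x ∈ (B n).idx, ψ b x = y)
    (h : ∀ n, ∀ i ∈ (A n).idx, ∀ j ∈ (B n).idx, ⟪(A n).vec i, (B n).vec j⟫_ℝ *
      ⟪(B n).vec j, (A n).vec i⟫_ℝ = σ n * K (ψ i j)) (hσ : ∀ n, 0 < n → σ n ≠ 0) :
    Tendsto (fun n : ℕ => (n : ℝ)⁻¹ * cyc2 (A n) (B n) / σ n) atTop (𝓝 (∑' y, K y)) := by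
  refine (tendsto_average_translates hK (fun n => (B n).idx) ψ hB hψ hcov).congr' ?_
  filter_upwards [eventually_gt_atTop 0] with n hn
  rw [eq_div_iff (hσ n hn), mul_assoc]
  congr 1
  rw [cyc2, Finset.sum_mul]
  refine Finset.sum_congr rfl fun i hi => ?_
  rw [Finset.sum_mul]
  exact Finset.sum_congr rfl fun j hj => by rw [h n i hi j hj, mul_comm]

theorem tendsto_cyc3 {A B C : ℕ → Family 𝔥} {K : ℤ × ℤ → ℝ} (hK : Summable K) (σ : ℕ → ℝ)
    (ψ : ℕ → ℕ × ℕ → ℤ × ℤ) (hB : ∀ n, (A n).idx.card ≤ n)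
    (hψ : ∀ b, Function.Injective (ψ b))
    (hcov : ∀ y, ∃ m, ∀ n b, m ≤ b → b + m ≤ n → b ∈ (A n).idx ∧
      ∃ x ∈ (B n).idx ×ˢ (C n).idx, ψ b x = y)
    (h : ∀ n, ∀ i ∈ (A n).idx, ∀ j ∈ (B n).idx, ∀ k ∈ (C n).idx, ⟪(A n).vec i, (B n).vec j⟫_ℝ *
      ⟪(B n).vec j, (C n).vec k⟫_ℝ * ⟪(C n).vec k, (A n).vec i⟫_ℝ = σ n * K (ψ i (j, k)))
    (hσ : ∀ n, 0 < n → σ n ≠ 0) :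
    Tendsto (fun n : ℕ => (n : ℝ)⁻¹ * cyc3 (A n) (B n) (C n) / σ n) atTop (𝓝 (∑' y, K y)) := by
  refine (tendsto_average_translates hK (fun n => (B n).idx ×ˢ (C n).idx) ψ hB hψ hcov).congr' ?_
  filter_upwards [eventually_gt_atTop 0] with n hn
  rw [eq_div_iff (hσ n hn), mul_assoc]
  congr 1
  rw [cyc3, Finset.sum_mul]
  refine Finset.sum_congr rfl fun i hi => ?_
  rw [Finset.sum_product, Finset.sum_mul]
  refine Finset.sum_congr rfl fun j hj => ?_
  rw [Finset.sum_mul]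
  exact Finset.sum_congr rfl fun k hk => by rw [h n i hi j hj k hk, mul_comm]

theorem tendsto_cyc4 {A B C D : ℕ → Family 𝔥} {K : ℤ × ℤ × ℤ → ℝ} (hK : Summable K) (σ : ℕ → ℝ)
    (ψ : ℕ → ℕ × ℕ × ℕ → ℤ × ℤ × ℤ) (hB : ∀ n, (A n).idx.card ≤ n)
    (hψ : ∀ b, Function.Injective (ψ b))
    (hcov : ∀ y, ∃ m, ∀ n b, m ≤ b → b + m ≤ n → b ∈ (A n).idx ∧
      ∃ x ∈ (B n).idx ×ˢ (C n).idx ×ˢ (D n).idx, ψ b x = y)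
    (h : ∀ n, ∀ i ∈ (A n).idx, ∀ j ∈ (B n).idx, ∀ k ∈ (C n).idx, ∀ l ∈ (D n).idx,
      ⟪(A n).vec i, (B n).vec j⟫_ℝ * ⟪(B n).vec j, (C n).vec k⟫_ℝ *
        ⟪(C n).vec k, (D n).vec l⟫_ℝ * ⟪(D n).vec l, (A n).vec i⟫_ℝ = σ n * K (ψ i (j, k, l)))
    (hσ : ∀ n, 0 < n → σ n ≠ 0) :
    Tendsto (fun n : ℕ => (n : ℝ)⁻¹ * cyc4 (A n) (B n) (C n) (D n) / σ n) atTop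
      (𝓝 (∑' y, K y)) := by
  refine (tendsto_average_translates hK (fun n => (B n).idx ×ˢ (C n).idx ×ˢ (D n).idx)
    ψ hB hψ hcov).congr' ?_
  filter_upwards [eventually_gt_atTop 0] with n hn
  rw [eq_div_iff (hσ n hn), mul_assoc]
  congr 1
  rw [cyc4, Finset.sum_mul]
  refine Finset.sum_congr rfl fun i hi => ?_
  rw [Finset.sum_product, Finset.sum_mul]
  refine Finset.sum_congr rfl fun j hj => ?_
  rw [Finset.sum_product, Finset.sum_mul]
  refine Finset.sum_congr rfl fun k hk => ?_
  rw [Finset.sum_mul]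
  exact Finset.sum_congr rfl fun l hl => by rw [h n i hi j hj k hk l hl, mul_comm]

end Family

end Cycles

/-! ### Gram matrices of the coarse and fine second differences. -/

section Gram

variable {H : Set.Ioo (0 : ℝ) 1} {T : ℝ}

/-- The variance scale `(T / m)^{2H}`. -/
noncomputable def scale (H : Set.Ioo (0 : ℝ) 1) (T : ℝ) (m : ℕ) : ℝ := (T / m) ^ (2 * (H : ℝ))

theorem scale_pos (hT : 0 < T) {m : ℕ} (hm : 0 < m) : 0 < scale H T m :=
  Real.rpow_pos_of_pos (div_pos hT (Nat.cast_pos.2 hm)) _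

theorem scale_eq (hT : 0 < T) (n : ℕ) :
    scale H T n = 2 ^ (2 * (H : ℝ)) * scale H T (2 * n) := by
  rw [scale, scale, ← Real.mul_rpow two_pos.le (by positivity)]
  congr 1
  push_cast
  rcases Nat.eq_zero_or_pos n with rfl | hn
  · simp
  · have : (n : ℝ) ≠ 0 := by positivity
    field_simp

theorem inner_ind_grid (hT : 0 < T) {m : ℕ} (hm : 0 < m) {x y : ℝ} (hx : x ∈ Set.Icc (0 : ℝ) m)
    (hy : y ∈ Set.Icc (0 : ℝ) m) :
    ⟪ind H T (grid T m x), ind H T (grid T m y)⟫_ℝ =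
      (grid T m x ^ (2 * (H : ℝ)) + grid T m y ^ (2 * (H : ℝ))
        - scale H T m * |x - y| ^ (2 * (H : ℝ))) / 2 := by
  have hm' : (0 : ℝ) < m := Nat.cast_pos.2 hm
  have hg : ∀ z ∈ Set.Icc (0 : ℝ) m, grid T m z ∈ Set.Icc 0 T := fun z hz => by
    refine ⟨div_nonneg (mul_nonneg hz.1 hT.le) hm'.le, ?_⟩
    rw [grid, div_le_iff₀ hm', mul_comm]
    exact mul_le_mul_of_nonneg_left hz.2 hT.le
  rw [inner_ind H (hg y hy) (hg x hx), covKernel, scale,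
    ← Real.mul_rpow (by positivity) (abs_nonneg _)]
  congr 3
  rw [← abs_of_pos (div_pos hT hm'), ← abs_mul]
  congr 1
  rw [grid, grid]; ring

/-- Covariance terms depending on one endpoint only are annihilated by differencing in the other.
What survives is a fourth difference of `|x|^{2H}`, homogeneous in the mesh. -/
theorem inner_stepDiff (hT : 0 < T) {m i j : ℕ} (hi : i ∈ Finset.Ico 1 m)
    (hj : j ∈ Finset.Ico 1 m) :
    ⟪stepDiff H T m i, stepDiff H T m j⟫_ℝ = scale H T m * rhoHat H ((i : ℤ) - j) := by
  rw [Finset.mem_Ico] at hi hj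
  have hm : 0 < m := by omega
  have h : ∀ k : ℕ, 1 ≤ k ∧ k < m → (k : ℝ) + 1 ∈ Set.Icc (0 : ℝ) m ∧
      (k : ℝ) ∈ Set.Icc (0 : ℝ) m ∧ (k : ℝ) - 1 ∈ Set.Icc (0 : ℝ) m := fun k hk => by
    have h1 : (1 : ℝ) ≤ k := by exact_mod_cast hk.1
    have h2 : (k : ℝ) + 1 ≤ m := by exact_mod_cast hk.2
    refine ⟨⟨?_, ?_⟩, ⟨?_, ?_⟩, ⟨?_, ?_⟩⟩ <;> linarith
  obtain ⟨i1, i2, i3⟩ := h i hi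
  obtain ⟨j1, j2, j3⟩ := h j hj
  simp only [stepDiff, inner_sub_left, inner_sub_right]
  rw [inner_ind_grid hT hm i1 j1, inner_ind_grid hT hm i1 j2, inner_ind_grid hT hm i1 j3,
    inner_ind_grid hT hm i2 j1, inner_ind_grid hT hm i2 j2, inner_ind_grid hT hm i2 j3,
    inner_ind_grid hT hm i3 j1, inner_ind_grid hT hm i3 j2, inner_ind_grid hT hm i3 j3, rhoHat]
  push_cast
  rw [show (i : ℝ) + 1 - (j + 1) = i - j by ring, show (i : ℝ) + 1 - j = i - j + 1 by ring,
    show (i : ℝ) + 1 - (j - 1) = i - j + 2 by ring, show (i : ℝ) - (j + 1) = i - j - 1 by ring,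
    show (i : ℝ) - (j - 1) = i - j + 1 by ring, show (i : ℝ) - 1 - (j + 1) = i - j - 2 by ring,
    show (i : ℝ) - 1 - (j - 1) = i - j by ring, show (i : ℝ) - 1 - j = i - j - 1 by ring]
  ring

/-- Each coarse increment is a sum of two adjacent fine ones, which reduces mixed inner products to
the fine grid. -/
theorem stepDiff_eq {n i : ℕ} (hi : 1 ≤ i) :
    stepDiff H T n i = stepDiff H T (2 * n) (2 * i + 1) + (2 : ℝ) • stepDiff H T (2 * n) (2 * i)
      + stepDiff H T (2 * n) (2 * i - 1) := by
  have hg : ∀ x : ℝ, grid T n x = grid T (2 * n) (2 * x) := fun x => by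
    rw [grid, grid]; push_cast
    rw [mul_assoc, mul_div_mul_left _ _ two_ne_zero]
  have h1 : ((2 * i - 1 : ℕ) : ℝ) = 2 * i - 1 := by
    rw [Nat.cast_sub (by omega)]; push_cast; ring
  simp only [stepDiff, hg, h1]
  push_cast
  rw [show (2 : ℝ) * (i + 1) = 2 * i + 1 + 1 by ring, show (2 : ℝ) * (i - 1) = 2 * i - 1 - 1 by ring,
    show (2 : ℝ) * i - 1 + 1 = 2 * i by ring, show (2 : ℝ) * i + 1 - 1 = 2 * i by ring]
  module

theorem inner_stepDiff_fine (hT : 0 < T) {n i j : ℕ} (hi : i ∈ Finset.Ico 1 n)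
    (hj : j ∈ Finset.Ico 1 (2 * n)) :
    ⟪stepDiff H T n i, stepDiff H T (2 * n) j⟫_ℝ = scale H T n * rhoTilde H (2 * (i : ℤ) - j) := by
  have hi' := Finset.mem_Ico.1 hi
  rw [stepDiff_eq hi'.1, inner_add_left, inner_add_left, real_inner_smul_left,
    inner_stepDiff hT (Finset.mem_Ico.2 ⟨by omega, by omega⟩) hj,
    inner_stepDiff hT (Finset.mem_Ico.2 ⟨by omega, by omega⟩) hj,
    inner_stepDiff hT (Finset.mem_Ico.2 ⟨by omega, by omega⟩) hj, rhoTilde_eq, scale_eq hT n]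
  have hp : (0 : ℝ) < 2 ^ (2 * (H : ℝ)) := by positivity
  rw [show ((2 * i + 1 : ℕ) : ℤ) - j = 2 * (i : ℤ) - j + 1 by push_cast; ring,
    show ((2 * i - 1 : ℕ) : ℤ) - j = 2 * (i : ℤ) - j - 1 by omega,
    show ((2 * i : ℕ) : ℤ) - j = 2 * (i : ℤ) - j by push_cast; ring]
  field_simp

theorem inner_fine_stepDiff (hT : 0 < T) {n i j : ℕ} (hi : i ∈ Finset.Ico 1 n)
    (hj : j ∈ Finset.Ico 1 (2 * n)) :
    ⟪stepDiff H T (2 * n) j, stepDiff H T n i⟫_ℝ = scale H T n * rhoTilde H ((j : ℤ) - 2 * i) := by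
  rw [real_inner_comm, inner_stepDiff_fine hT hi hj, rhoTilde_sub_comm]

theorem rhoHat_congr {H : ℝ} {x y : ℤ} (h : x = y ∨ x = -y) : rhoHat H x = rhoHat H y := by
  rcases h with rfl | rfl
  · rfl
  · exact rhoHat_neg H y

theorem rhoTilde_congr {H : ℝ} {x y : ℤ} (h : x = y ∨ x = -y) :
    rhoTilde H x = rhoTilde H y := by
  rcases h with rfl | rfl
  · rfl
  · exact rhoTilde_neg H y

end Gram

/-! ### Limits of the cyclic sums over coarse and fine vertices. -/

section Limits

open Family

/-- The family of the second order differences of the indicators on the grid of mesh `T / m`. -/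
noncomputable def gridFamily (H : Set.Ioo (0 : ℝ) 1) (T : ℝ) (m : ℕ) : Family (CMSpace H T) :=
  ⟨Finset.Ico 1 m, stepDiff H T m⟩

/-- The members of the fine family with an even index. -/
noncomputable def evenFamily (H : Set.Ioo (0 : ℝ) 1) (T : ℝ) (n : ℕ) : Family (CMSpace H T) :=
  ⟨Finset.Ico 1 n, fun b => stepDiff H T (2 * n) (2 * b)⟩

/-- The members of the fine family with an odd index. -/
noncomputable def oddFamily (H : Set.Ioo (0 : ℝ) 1) (T : ℝ) (n : ℕ) : Family (CMSpace H T) :=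
  ⟨Finset.range n, fun b => stepDiff H T (2 * n) (2 * b + 1)⟩

theorem sum_Ico_two_mul (n : ℕ) (g : ℕ → ℝ) :
    ∑ j ∈ Finset.Ico 1 (2 * n), g j =
      ∑ b ∈ Finset.Ico 1 n, g (2 * b) + ∑ b ∈ Finset.range n, g (2 * b + 1) := by
  induction n with
  | zero => simp
  | succ n ih =>
    rcases Nat.eq_zero_or_pos n with rfl | hn
    · simp
    · rw [show 2 * (n + 1) = 2 * n + 1 + 1 by ring, Finset.sum_Ico_succ_top (by omega),
        Finset.sum_Ico_succ_top (by omega), Finset.sum_Ico_succ_top (by omega),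
        Finset.sum_range_succ, ih]
      ring

variable {H : Set.Ioo (0 : ℝ) 1} {T : ℝ}

/-- A coarse step moves fine indices by two, so a fine base vertex sees the coarse grid differently
according to its parity. Each parity class is averaged separately. -/
theorem cyc4_grid_two_mul (n : ℕ) (A B C : Family (CMSpace H T)) :
    cyc4 (gridFamily H T (2 * n)) A B C =
      cyc4 (evenFamily H T n) A B C + cyc4 (oddFamily H T n) A B C :=
  sum_Ico_two_mul n _

theorem card_gridFamily_le (n : ℕ) : (gridFamily H T n).idx.card ≤ n := by
  simp [gridFamily]

/-- In these names `C` is the grid with `n` steps and `F` the one with `2n`; the letters list the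
vertices, base first. -/
theorem tendsto_cyc2_CC (hT : 0 < T) :
    Tendsto (fun n : ℕ => (n : ℝ)⁻¹ * cyc2 (gridFamily H T n) (gridFamily H T n)
      / scale H T n ^ 2) atTop (𝓝 (∑' j, rhoHat H j ^ 2)) := by
  refine tendsto_cyc2 (summable_sq_of_summable (summable_rhoHat H.2.2)) _
    (fun b x => (b : ℤ) - x) card_gridFamily_le (fun b x y h => by grind) (fun y => ?_)
    (fun n i hi j hj => ?_) fun n hn => (pow_pos (scale_pos hT hn) _).ne'
  -- The other vertex is found by solving `ψ b x = y`; the margin `|y| + 2` keeps it inside the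
  -- index range. The later cycles use the same device.
  · refine ⟨y.natAbs + 2, fun n b h1 h2 => ⟨?_, (b - y).toNat, ?_, by omega⟩⟩ <;>
      simp [gridFamily] <;> omega
  · simp only [gridFamily] at hi hj ⊢
    rw [inner_stepDiff hT hi hj, inner_stepDiff hT hj hi, rhoHat_sub_comm _ (j : ℤ)]
    ring

theorem tendsto_cyc2_CF (hT : 0 < T) :
    Tendsto (fun n : ℕ => (n : ℝ)⁻¹ * cyc2 (gridFamily H T n) (gridFamily H T (2 * n))
      / scale H T n ^ 2) atTop (𝓝 (∑' j, term12 H j)) := by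
  refine tendsto_cyc2 (summable_sq_of_summable (summable_rhoTilde H.2.2)) _
    (fun b x => 2 * (b : ℤ) - x) card_gridFamily_le (fun b x y h => by grind) (fun y => ?_)
    (fun n i hi j hj => ?_) fun n hn => (pow_pos (scale_pos hT hn) _).ne'
  · refine ⟨y.natAbs + 2, fun n b h1 h2 => ⟨?_, (2 * b - y).toNat, ?_, by omega⟩⟩ <;>
      simp [gridFamily] <;> omega
  · simp only [gridFamily] at hi hj ⊢
    rw [inner_stepDiff_fine hT hi hj, inner_fine_stepDiff hT hi hj, rhoTilde_sub_comm _ (j : ℤ)]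
    ring

theorem tendsto_cyc3_CCC (hT : 0 < T) :
    Tendsto (fun n : ℕ => (n : ℝ)⁻¹ * cyc3 (gridFamily H T n) (gridFamily H T n)
      (gridFamily H T n) / scale H T n ^ 3) atTop (𝓝 (∑' j, term1_11 H j)) := by
  refine tendsto_cyc3 (seriesConverge H.2.2).2.2.1 _
    (fun b x => ((x.1 : ℤ) - b, (x.2 : ℤ) - b)) card_gridFamily_le (fun b x y h => by grind)
    (fun ⟨y₁, y₂⟩ => ?_) (fun n i hi j hj k hk => ?_) fun n hn => (pow_pos (scale_pos hT hn) _).ne'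
  · refine ⟨y₁.natAbs + y₂.natAbs + 2, fun n b h1 h2 => ⟨?_, ((y₁ + b).toNat, (y₂ + b).toNat), ?_,
      Prod.ext ?_ ?_⟩⟩ <;> simp [gridFamily] <;> omega
  · simp only [gridFamily] at hi hj hk ⊢
    rw [inner_stepDiff hT hi hj, inner_stepDiff hT hj hk, inner_stepDiff hT hk hi]
    simp only [term1_11]
    rw [rhoHat_congr (x := (j : ℤ) - i) (y := i - j) (by omega),
      rhoHat_congr (x := (j : ℤ) - i - (k - i)) (y := j - k) (by omega)]
    ring

theorem tendsto_cyc3_CCF (hT : 0 < T) :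
    Tendsto (fun n : ℕ => (n : ℝ)⁻¹ * cyc3 (gridFamily H T n) (gridFamily H T n)
      (gridFamily H T (2 * n)) / scale H T n ^ 3) atTop (𝓝 (∑' j, term2_11 H j)) := by
  refine tendsto_cyc3 (seriesConverge H.2.2).2.2.2.1 _
    (fun b x => ((x.1 : ℤ) - b, (x.2 : ℤ) - 2 * b)) card_gridFamily_le (fun b x y h => by grind)
    (fun ⟨y₁, y₂⟩ => ?_) (fun n i hi j hj k hk => ?_) fun n hn => (pow_pos (scale_pos hT hn) _).ne'
  · refine ⟨y₁.natAbs + y₂.natAbs + 2, fun n b h1 h2 => ⟨?_, ((y₁ + b).toNat, (y₂ + 2 * b).toNat),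
      ?_, Prod.ext ?_ ?_⟩⟩ <;> simp [gridFamily] <;> omega
  · simp only [gridFamily] at hi hj hk ⊢
    rw [inner_stepDiff hT hi hj, inner_stepDiff_fine hT hj hk, inner_fine_stepDiff hT hi hk]
    simp only [term2_11]
    rw [rhoHat_congr (x := (j : ℤ) - i) (y := i - j) (by omega),
      rhoTilde_congr (x := (k : ℤ) - 2 * i - 2 * (j - i)) (y := 2 * j - k) (by omega)]
    ring

/-- Coarse and mixed inner products carry the coarse scale, and only a fine-fine edge carries `scale
H T (2 * n)`. This fixes the normalisation here and for the longer cycles. -/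
theorem tendsto_cyc3_CFF (hT : 0 < T) :
    Tendsto (fun n : ℕ => (n : ℝ)⁻¹ * cyc3 (gridFamily H T n) (gridFamily H T (2 * n))
      (gridFamily H T (2 * n)) / (scale H T n ^ 2 * scale H T (2 * n))) atTop
      (𝓝 (∑' j, term1_22 H j)) := by
  refine tendsto_cyc3 (seriesConverge H.2.2).2.2.2.2.1 _
    -- Positions are measured from the fine vertex `x.1`, since the series has `ρ̂` of its first
    -- index on the fine-fine edge. For fixed `b` the map is still injective.
    (fun b x => ((x.2 : ℤ) - x.1, 2 * (b : ℤ) - x.1)) card_gridFamily_le (fun b x y h => by grind)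
    (fun ⟨y₁, y₂⟩ => ?_) (fun n i hi j hj k hk => ?_)
    fun n hn => (mul_pos (pow_pos (scale_pos hT hn) _) (scale_pos hT (by omega))).ne'
  · refine ⟨y₁.natAbs + y₂.natAbs + 2, fun n b h1 h2 => ⟨?_,
      ((2 * b - y₂).toNat, (2 * b - y₂ + y₁).toNat), ?_, Prod.ext ?_ ?_⟩⟩ <;>
      simp [gridFamily] <;> omega
  · simp only [gridFamily] at hi hj hk ⊢
    rw [inner_stepDiff_fine hT hi hj, inner_stepDiff hT hj hk, inner_fine_stepDiff hT hi hk]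
    simp only [term1_22]
    rw [rhoHat_congr (x := (k : ℤ) - j) (y := j - k) (by omega),
      rhoTilde_congr (x := (k : ℤ) - j - (2 * i - j)) (y := k - 2 * i) (by omega)]
    ring

theorem tendsto_cyc4_CCCC (hT : 0 < T) :
    Tendsto (fun n : ℕ => (n : ℝ)⁻¹ * cyc4 (gridFamily H T n) (gridFamily H T n)
      (gridFamily H T n) (gridFamily H T n) / scale H T n ^ 4) atTop
      (𝓝 (∑' j, term11_11 H j)) := by
  refine tendsto_cyc4 (seriesConverge H.2.2).2.2.2.2.2.1 _
    (fun b x => ((x.1 : ℤ) - b, (x.2.1 : ℤ) - b, (x.2.2 : ℤ) - b)) card_gridFamily_le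
    (fun b x y h => by grind)
    (fun ⟨y₁, y₂, y₃⟩ => ?_) (fun n i hi j hj k hk l hl => ?_)
    fun n hn => (pow_pos (scale_pos hT hn) _).ne'
  · refine ⟨y₁.natAbs + y₂.natAbs + y₃.natAbs + 2, fun n b h1 h2 => ⟨?_,
      ((y₁ + b).toNat, (y₂ + b).toNat, (y₃ + b).toNat), ?_,
      Prod.ext ?_ (Prod.ext ?_ ?_)⟩⟩ <;> simp [gridFamily] <;> omega
  · simp only [gridFamily] at hi hj hk hl ⊢
    rw [inner_stepDiff hT hi hj, inner_stepDiff hT hj hk, inner_stepDiff hT hk hl,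
      inner_stepDiff hT hl hi]
    simp only [term11_11]
    rw [rhoHat_congr (x := (j : ℤ) - i) (y := i - j) (by omega),
      rhoHat_congr (x := (j : ℤ) - i - (k - i)) (y := j - k) (by omega),
      rhoHat_congr (x := (k : ℤ) - i - (l - i)) (y := k - l) (by omega)]
    ring

theorem tendsto_cyc4_CCFC (hT : 0 < T) :
    Tendsto (fun n : ℕ => (n : ℝ)⁻¹ * cyc4 (gridFamily H T n) (gridFamily H T n)
      (gridFamily H T (2 * n)) (gridFamily H T n) / scale H T n ^ 4) atTop
      (𝓝 (∑' j, term11_12 H j)) := by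
  refine tendsto_cyc4 (seriesConverge H.2.2).2.2.2.2.2.2.2.1 _
    (fun b x => ((x.1 : ℤ) - b, (x.2.1 : ℤ) - 2 * b, (x.2.2 : ℤ) - b)) card_gridFamily_le
    (fun b x y h => by grind)
    (fun ⟨y₁, y₂, y₃⟩ => ?_) (fun n i hi j hj k hk l hl => ?_)
    fun n hn => (pow_pos (scale_pos hT hn) _).ne'
  · refine ⟨y₁.natAbs + y₂.natAbs + y₃.natAbs + 2, fun n b h1 h2 => ⟨?_,
      ((y₁ + b).toNat, (y₂ + 2 * b).toNat, (y₃ + b).toNat), ?_,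
      Prod.ext ?_ (Prod.ext ?_ ?_)⟩⟩ <;> simp [gridFamily] <;> omega
  · simp only [gridFamily] at hi hj hk hl ⊢
    rw [inner_stepDiff hT hi hj, inner_stepDiff_fine hT hj hk, inner_fine_stepDiff hT hl hk,
      inner_stepDiff hT hl hi]
    simp only [term11_12]
    rw [rhoHat_congr (x := (j : ℤ) - i) (y := i - j) (by omega),
      rhoTilde_congr (x := 2 * ((j : ℤ) - i) - (k - 2 * i)) (y := 2 * j - k) (by omega),
      rhoTilde_congr (x := (k : ℤ) - 2 * i - 2 * (l - i)) (y := k - 2 * l) (by omega)]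
    ring

theorem tendsto_cyc4_CFFF (hT : 0 < T) :
    Tendsto (fun n : ℕ => (n : ℝ)⁻¹ * cyc4 (gridFamily H T n) (gridFamily H T (2 * n))
      (gridFamily H T (2 * n)) (gridFamily H T (2 * n)) /
        (scale H T n ^ 2 * scale H T (2 * n) ^ 2)) atTop (𝓝 (∑' j, term12_22 H j)) := by
  refine tendsto_cyc4 (seriesConverge H.2.2).2.2.2.2.2.2.2.2.1 _
    (fun b x => ((x.2.1 : ℤ) - x.1, (x.2.2 : ℤ) - x.1, 2 * (b : ℤ) - x.1)) card_gridFamily_le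
    (fun b x y h => by grind)
    (fun ⟨y₁, y₂, y₃⟩ => ?_) (fun n i hi j hj k hk l hl => ?_)
    fun n hn => (mul_pos (pow_pos (scale_pos hT hn) _) (pow_pos (scale_pos hT (by omega)) _)).ne'
  · refine ⟨y₁.natAbs + y₂.natAbs + y₃.natAbs + 2, fun n b h1 h2 => ⟨?_,
      ((2 * b - y₃).toNat, (2 * b - y₃ + y₁).toNat, (2 * b - y₃ + y₂).toNat), ?_,
      Prod.ext ?_ (Prod.ext ?_ ?_)⟩⟩ <;> simp [gridFamily] <;> omega
  · simp only [gridFamily] at hi hj hk hl ⊢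
    rw [inner_stepDiff_fine hT hi hj, inner_stepDiff hT hj hk, inner_stepDiff hT hk hl,
      inner_fine_stepDiff hT hi hl]
    simp only [term12_22]
    rw [rhoHat_congr (x := (k : ℤ) - j) (y := j - k) (by omega),
      rhoHat_congr (x := (k : ℤ) - j - (l - j)) (y := k - l) (by omega),
      rhoTilde_congr (x := (l : ℤ) - j - (2 * i - j)) (y := l - 2 * i) (by omega)]
    ring

theorem tendsto_cyc4_CCFF (hT : 0 < T) :
    Tendsto (fun n : ℕ => (n : ℝ)⁻¹ * cyc4 (gridFamily H T n) (gridFamily H T n)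
      (gridFamily H T (2 * n)) (gridFamily H T (2 * n)) /
        (scale H T n ^ 3 * scale H T (2 * n))) atTop (𝓝 (∑' j, term12_12a H j)) := by
  refine tendsto_cyc4 (seriesConverge H.2.2).2.2.2.2.2.2.2.2.2.1 _
    (fun b x => ((x.1 : ℤ) - b, (x.2.1 : ℤ) - 2 * b, (x.2.2 : ℤ) - 2 * b)) card_gridFamily_le
    (fun b x y h => by grind)
    (fun ⟨y₁, y₂, y₃⟩ => ?_) (fun n i hi j hj k hk l hl => ?_)
    fun n hn => (mul_pos (pow_pos (scale_pos hT hn) _) (scale_pos hT (by omega))).ne'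
  · refine ⟨y₁.natAbs + y₂.natAbs + y₃.natAbs + 2, fun n b h1 h2 => ⟨?_,
      ((y₁ + b).toNat, (y₂ + 2 * b).toNat, (y₃ + 2 * b).toNat), ?_,
      Prod.ext ?_ (Prod.ext ?_ ?_)⟩⟩ <;> simp [gridFamily] <;> omega
  · simp only [gridFamily] at hi hj hk hl ⊢
    rw [inner_stepDiff hT hi hj, inner_stepDiff_fine hT hj hk, inner_stepDiff hT hk hl,
      inner_fine_stepDiff hT hi hl]
    simp only [term12_12a]
    rw [rhoHat_congr (x := (j : ℤ) - i) (y := i - j) (by omega),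
      rhoTilde_congr (x := 2 * ((j : ℤ) - i) - (k - 2 * i)) (y := 2 * j - k) (by omega),
      rhoHat_congr (x := (k : ℤ) - 2 * i - (l - 2 * i)) (y := k - l) (by omega)]
    ring

theorem mem_evenFamily {n i : ℕ} (hi : i ∈ Finset.Ico 1 n) : 2 * i ∈ Finset.Ico 1 (2 * n) := by
  simp only [Finset.mem_Ico] at hi ⊢; omega

theorem mem_oddFamily {n i : ℕ} (hi : i ∈ Finset.range n) :
    2 * i + 1 ∈ Finset.Ico 1 (2 * n) := by
  simp only [Finset.mem_Ico, Finset.mem_range] at hi ⊢; omega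

theorem tendsto_cyc4_FCCF (hT : 0 < T) :
    Tendsto (fun n : ℕ => (n : ℝ)⁻¹ * cyc4 (gridFamily H T (2 * n)) (gridFamily H T n)
      (gridFamily H T n) (gridFamily H T (2 * n)) /
        (scale H T n ^ 3 * scale H T (2 * n))) atTop (𝓝 (∑' j, term11_22 H j)) := by
  have he := tendsto_cyc4 (A := evenFamily H T) (B := gridFamily H T) (C := gridFamily H T)
    (D := fun n => gridFamily H T (2 * n)) (summable_term11_22_even H.2.2)
    (fun n => scale H T n ^ 3 * scale H T (2 * n))
    (fun b x => ((x.1 : ℤ) - b, (x.2.1 : ℤ) - b, (x.2.2 : ℤ) - 2 * b))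
    (fun n => by simp [evenFamily]) (fun b x y h => by grind)
    (fun ⟨y₁, y₂, y₃⟩ => by
      refine ⟨y₁.natAbs + y₂.natAbs + y₃.natAbs + 2, fun n b h1 h2 => ⟨?_,
        ((y₁ + b).toNat, (y₂ + b).toNat, (y₃ + 2 * b).toNat), ?_,
        Prod.ext ?_ (Prod.ext ?_ ?_)⟩⟩ <;> simp [gridFamily, evenFamily] <;> omega)
    (fun n i hi j hj k hk l hl => by
      simp only [gridFamily, evenFamily] at hi hj hk hl ⊢
      rw [inner_fine_stepDiff hT hj (mem_evenFamily hi), inner_stepDiff hT hj hk,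
        inner_stepDiff_fine hT hk hl, inner_stepDiff hT hl (mem_evenFamily hi)]
      push_cast
      rw [rhoTilde_congr (x := 2 * ((j : ℤ) - i)) (y := 2 * i - 2 * j) (by omega),
        rhoHat_congr (x := (j : ℤ) - i - (k - i)) (y := j - k) (by omega),
        rhoTilde_congr (x := 2 * ((k : ℤ) - i) - (l - 2 * i)) (y := 2 * k - l) (by omega)]
      ring)
    fun n hn => (mul_pos (pow_pos (scale_pos hT hn) _) (scale_pos hT (by omega))).ne'
  have ho := tendsto_cyc4 (A := oddFamily H T) (B := gridFamily H T) (C := gridFamily H T)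
    (D := fun n => gridFamily H T (2 * n)) (summable_term11_22_odd H.2.2)
    (fun n => scale H T n ^ 3 * scale H T (2 * n))
    -- The base is the fine index `2b + 1`. Measuring coarse vertices from `b + 1` makes `2j - (2b +
    -- 1)` the odd argument `2 (j - b - 1) + 1`; the fine vertex, adjacent to the base, is measured
    -- from the base itself.
    (fun b x => ((x.1 : ℤ) - b - 1, (x.2.1 : ℤ) - b - 1, (x.2.2 : ℤ) - 2 * b - 1))
    (fun n => by simp [oddFamily]) (fun b x y h => by grind)
    (fun ⟨y₁, y₂, y₃⟩ => by
      refine ⟨y₁.natAbs + y₂.natAbs + y₃.natAbs + 3, fun n b h1 h2 => ⟨?_,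
        ((y₁ + b + 1).toNat, (y₂ + b + 1).toNat, (y₃ + 2 * b + 1).toNat), ?_,
        Prod.ext ?_ (Prod.ext ?_ ?_)⟩⟩ <;> simp [gridFamily, oddFamily] <;> omega)
    (fun n i hi j hj k hk l hl => by
      simp only [gridFamily, oddFamily] at hi hj hk hl ⊢
      rw [inner_fine_stepDiff hT hj (mem_oddFamily hi), inner_stepDiff hT hj hk,
        inner_stepDiff_fine hT hk hl, inner_stepDiff hT hl (mem_oddFamily hi)]
      push_cast
      rw [rhoTilde_congr (x := 2 * ((j : ℤ) - i - 1) + 1) (y := 2 * i + 1 - 2 * j) (by omega),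
        rhoHat_congr (x := (j : ℤ) - i - 1 - (k - i - 1)) (y := j - k) (by omega),
        rhoTilde_congr (x := 2 * ((k : ℤ) - i - 1) - (l - 2 * i - 1) + 1) (y := 2 * k - l)
          (by omega),
        rhoHat_congr (x := (l : ℤ) - 2 * i - 1) (y := l - (2 * i + 1)) (by omega)]
      ring)
    fun n hn => (mul_pos (pow_pos (scale_pos hT hn) _) (scale_pos hT (by omega))).ne'
  have hs : ∑' j, term11_22 H j = _ :=
    (summable_term11_22_even H.2.2).tsum_add (summable_term11_22_odd H.2.2)
  rw [hs]
  refine (he.add ho).congr fun n => ?_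
  rw [cyc4_grid_two_mul]
  ring

theorem tendsto_cyc4_FCFC (hT : 0 < T) :
    Tendsto (fun n : ℕ => (n : ℝ)⁻¹ * cyc4 (gridFamily H T (2 * n)) (gridFamily H T n)
      (gridFamily H T (2 * n)) (gridFamily H T n) / scale H T n ^ 4) atTop
      (𝓝 (∑' j, term12_12b H j + ∑' j, term12_12c H j)) := by
  have he := tendsto_cyc4 (A := evenFamily H T) (B := gridFamily H T)
    (C := fun n => gridFamily H T (2 * n))
    (D := gridFamily H T) (seriesConverge H.2.2).2.2.2.2.2.2.2.2.2.2.1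
    (fun n => scale H T n ^ 4)
    (fun b x => ((x.1 : ℤ) - b, (x.2.1 : ℤ) - 2 * b, (x.2.2 : ℤ) - b))
    (fun n => by simp [evenFamily]) (fun b x y h => by grind)
    (fun ⟨y₁, y₂, y₃⟩ => by
      refine ⟨y₁.natAbs + y₂.natAbs + y₃.natAbs + 2, fun n b h1 h2 => ⟨?_,
        ((y₁ + b).toNat, (y₂ + 2 * b).toNat, (y₃ + b).toNat), ?_,
        Prod.ext ?_ (Prod.ext ?_ ?_)⟩⟩ <;> simp [gridFamily, evenFamily] <;> omega)
    (fun n i hi j hj k hk l hl => by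
      simp only [gridFamily, evenFamily] at hi hj hk hl ⊢
      rw [inner_fine_stepDiff hT hj (mem_evenFamily hi), inner_stepDiff_fine hT hj hk,
        inner_fine_stepDiff hT hl hk, inner_stepDiff_fine hT hl (mem_evenFamily hi)]
      push_cast
      simp only [term12_12b]
      rw [rhoTilde_congr (x := 2 * ((j : ℤ) - i)) (y := 2 * i - 2 * j) (by omega),
        rhoTilde_congr (x := 2 * ((j : ℤ) - i) - (k - 2 * i)) (y := 2 * j - k) (by omega),
        rhoTilde_congr (x := (k : ℤ) - 2 * i - 2 * (l - i)) (y := k - 2 * l) (by omega),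
        rhoTilde_congr (x := 2 * ((l : ℤ) - i)) (y := 2 * l - 2 * i) (by omega)]
      ring)
    fun n hn => (pow_pos (scale_pos hT hn) _).ne'
  have ho := tendsto_cyc4 (A := oddFamily H T) (B := gridFamily H T)
    (C := fun n => gridFamily H T (2 * n))
    (D := gridFamily H T) (seriesConverge H.2.2).2.2.2.2.2.2.2.2.2.2.2
    (fun n => scale H T n ^ 4)
    -- Now the second fine vertex has only coarse neighbours, so it is measured from `2 (b + 1)`,
    -- twice their reference point.
    (fun b x => ((x.1 : ℤ) - b - 1, (x.2.1 : ℤ) - 2 * b - 2, (x.2.2 : ℤ) - b - 1))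
    (fun n => by simp [oddFamily]) (fun b x y h => by grind)
    (fun ⟨y₁, y₂, y₃⟩ => by
      refine ⟨y₁.natAbs + y₂.natAbs + y₃.natAbs + 3, fun n b h1 h2 => ⟨?_,
        ((y₁ + b + 1).toNat, (y₂ + 2 * b + 2).toNat, (y₃ + b + 1).toNat), ?_,
        Prod.ext ?_ (Prod.ext ?_ ?_)⟩⟩ <;> simp [gridFamily, oddFamily] <;> omega)
    (fun n i hi j hj k hk l hl => by
      simp only [gridFamily, oddFamily] at hi hj hk hl ⊢
      rw [inner_fine_stepDiff hT hj (mem_oddFamily hi), inner_stepDiff_fine hT hj hk,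
        inner_fine_stepDiff hT hl hk, inner_stepDiff_fine hT hl (mem_oddFamily hi)]
      push_cast
      simp only [term12_12c]
      rw [rhoTilde_congr (x := 2 * ((j : ℤ) - i - 1) + 1) (y := 2 * i + 1 - 2 * j) (by omega),
        rhoTilde_congr (x := 2 * ((j : ℤ) - i - 1) - (k - 2 * i - 2)) (y := 2 * j - k) (by omega),
        rhoTilde_congr (x := (k : ℤ) - 2 * i - 2 - 2 * (l - i - 1)) (y := k - 2 * l) (by omega),
        rhoTilde_congr (x := 2 * ((l : ℤ) - i - 1) + 1) (y := 2 * l - (2 * i + 1)) (by omega)]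
      ring)
    fun n hn => (pow_pos (scale_pos hT hn) _).ne'
  refine (he.add ho).congr fun n => ?_
  rw [cyc4_grid_two_mul]
  ring

end Limits

/-! ### Expansion of the forms in a difference of two kernels. -/

section Expansion

open Family

variable {𝔥 : Type*} [NormedAddCommGroup 𝔥] [InnerProductSpace ℝ 𝔥]

theorem inner_diag_sub_diag (F G : Family 𝔥) (p q : ℝ) :
    ⟪p • F.diag - q • G.diag, p • F.diag - q • G.diag⟫_ℝ =
      p ^ 2 * cyc2 F F - 2 * (p * q) * cyc2 F G + q ^ 2 * cyc2 G G := by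
  simp only [inner_sub_left, inner_sub_right, inner_smul_left_tensor, inner_smul_right_tensor]
  rw [real_inner_comm F.diag G.diag]
  simp only [inner_diag_diag]
  ring

theorem contrₗ_diag_sub_diag (F G : Family 𝔥) (p q : ℝ) :
    contrₗ (p • F.diag - q • G.diag) (p • F.diag - q • G.diag) =
      p ^ 2 • contrₗ F.diag F.diag - (p * q) • contrₗ F.diag G.diag
        - (p * q) • contrₗ G.diag F.diag + q ^ 2 • contrₗ G.diag G.diag := by
  simp only [map_sub, map_smul, LinearMap.sub_apply, LinearMap.smul_apply]
  module

theorem inner_contrₗ_diag_sub_diag (F G : Family 𝔥) (p q : ℝ) :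
    ⟪p • F.diag - q • G.diag,
      contrₗ (p • F.diag - q • G.diag) (p • F.diag - q • G.diag)⟫_ℝ =
      p ^ 3 * cyc3 F F F - 3 * (p ^ 2 * q) * cyc3 F F G + 3 * (p * q ^ 2) * cyc3 F G G
        - q ^ 3 * cyc3 G G G := by
  rw [contrₗ_diag_sub_diag]
  simp only [inner_sub_left, inner_sub_right, inner_add_right, inner_smul_left_tensor,
    inner_smul_right_tensor, inner_diag_contrₗ]
  rw [cyc3_swap F G F, cyc3_rotate G F F, cyc3_swap G F G, cyc3_rotate G G F, cyc3_rotate G F G]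
  ring

/-- Sixteen words in `F`, `G` are grouped by rotation. The six words with two `G` form two classes:
four with adjacent `G`, two alternating. -/
theorem inner_contrₗ_contrₗ_diag_sub_diag (F G : Family 𝔥) (p q : ℝ) :
    ⟪contrₗ (p • F.diag - q • G.diag) (p • F.diag - q • G.diag),
      contrₗ (p • F.diag - q • G.diag) (p • F.diag - q • G.diag)⟫_ℝ =
      p ^ 4 * cyc4 F F F F - 4 * (p ^ 3 * q) * cyc4 F F G F
        + (p ^ 2 * q ^ 2) * (4 * cyc4 F F G G + 2 * cyc4 G F G F)
        - 4 * (p * q ^ 3) * cyc4 F G G G + q ^ 4 * cyc4 G G G G := by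
  rw [contrₗ_diag_sub_diag]
  simp only [inner_sub_left, inner_sub_right, inner_add_right, inner_add_left,
    inner_smul_left_tensor, inner_smul_right_tensor, inner_contrₗ_contrₗ]
  have a1 : cyc4 F F F G = cyc4 F F G F := cyc4_rotate _ _ _ _
  have a2 : cyc4 G F F F = cyc4 F F G F := (cyc4_rotate _ _ _ _).trans a1
  have a3 : cyc4 F G F F = cyc4 F F G F := (cyc4_rotate _ _ _ _).trans a2
  have b1 : cyc4 G F F G = cyc4 F F G G := cyc4_rotate _ _ _ _
  have b2 : cyc4 G G F F = cyc4 F F G G := (cyc4_rotate _ _ _ _).trans b1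
  have b3 : cyc4 F G G F = cyc4 F F G G := (cyc4_rotate _ _ _ _).trans b2
  have c1 : cyc4 F G F G = cyc4 G F G F := cyc4_rotate _ _ _ _
  have d1 : cyc4 G F G G = cyc4 F G G G := cyc4_rotate _ _ _ _
  have d2 : cyc4 G G F G = cyc4 F G G G := (cyc4_rotate _ _ _ _).trans d1
  have d3 : cyc4 G G G F = cyc4 F G G G := (cyc4_rotate _ _ _ _).trans d2
  simp only [a1, a2, a3, b1, b2, b3, c1, d1, d2, d3]
  ring

end Expansion

/-! ### `Σ₁₁` as a sum over all integers. -/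

section Constants

theorem cH_pos {H : ℝ} (h1 : H < 1) : 0 < cH H := by
  have : (2 : ℝ) ^ (2 * H) < 2 ^ (2 : ℝ) := Real.rpow_lt_rpow_of_exponent_lt one_lt_two (by linarith)
  have h4 : (2 : ℝ) ^ (2 : ℝ) = 4 := by norm_num
  rw [cH]; linarith

theorem tsum_rhoHat_sq {H : ℝ} (h0 : 0 < H) (h1 : H < 1) :
    ∑' j, rhoHat H j ^ 2 = cH H ^ 2 + 2 * ∑' k, term11 H k := by
  have hs : Summable fun k : ℕ => rhoHat H ((k + 1 : ℕ) : ℤ) ^ 2 := by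
    refine (seriesConverge h1).1.congr fun k => ?_
    rw [term11, Nat.cast_succ]
  have hs' : Summable fun k : ℕ => rhoHat H (k : ℤ) ^ 2 := (summable_nat_add_iff 1).1 hs
  have e1 : ∑' k : ℕ, rhoHat H (k : ℤ) ^ 2 = cH H ^ 2 + ∑' k, term11 H k := by
    rw [hs'.tsum_eq_zero_add]
    simp [rhoHat_zero h0, term11]
  have e2 : ∀ k : ℕ, rhoHat H (-(k + 1 : ℤ)) ^ 2 = term11 H k := fun k => by
    rw [rhoHat_neg, term11]
  have h := HasSum.of_nat_of_neg_add_one (f := fun j => rhoHat H j ^ 2) hs'.hasSum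
    ((summable_congr e2).2 (seriesConverge h1).1).hasSum
  rw [h.tsum_eq, e1]
  simp_rw [e2]
  ring

theorem Sigma11_eq {H : ℝ} (h0 : 0 < H) (h1 : H < 1) :
    Sigma11 H = 2 / cH H ^ 2 * ∑' j, rhoHat H j ^ 2 := by
  have := (cH_pos h1).ne'
  rw [tsum_rhoHat_sq h0 h1, Sigma11]
  field_simp

end Constants

/-! ### Second differences as isonormal variables, weights and row sums. -/

section Limits

open Family

variable {H : Set.Ioo (0 : ℝ) 1} {T : ℝ} {Ω : Type*} {mΩ : MeasurableSpace Ω} {P : Measure Ω}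
  {W : CMSpace H T → Ω → ℝ}

theorem secondDiff_ae_eq (hW : IsIsonormal W P) (m j : ℕ) :
    secondDiff W m j =ᵐ[P] W (stepDiff H T m j) := by
  have e : stepDiff H T m j = (-2 : ℝ) • ind H T (grid T m j) +
      ((1 : ℝ) • ind H T (grid T m (j + 1)) + ind H T (grid T m (j - 1))) := by
    rw [stepDiff]; module
  rw [e]
  filter_upwards [hW.ae_eq_smul_add (-2) (ind H T (grid T m j))
      ((1 : ℝ) • ind H T (grid T m (j + 1)) + ind H T (grid T m (j - 1))),
    hW.ae_eq_smul_add 1 (ind H T (grid T m (j + 1))) (ind H T (grid T m (j - 1)))] with ω h1 h2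
  rw [h1, h2, secondDiff, fBM, fBM, fBM]
  ring

theorem integral_secondDiff_sq (hW : IsIsonormal W P) (m j : ℕ) :
    ∫ ω, secondDiff W m j ω ^ 2 ∂P = ‖stepDiff H T m j‖ ^ 2 := by
  rw [← real_inner_self_eq_norm_sq, ← hW.covariance]
  refine integral_congr_ae ?_
  filter_upwards [secondDiff_ae_eq hW m j] with ω h
  rw [h, sq]

theorem memLp_secondDiff (hW : IsIsonormal W P) (m j : ℕ) : MemLp (secondDiff W m j) 2 P :=
  (memLp_congr_ae (secondDiff_ae_eq hW m j)).2 (hW.memLp _)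

theorem meanV₂_eq_sum (hW : IsIsonormal W P) (m : ℕ) :
    meanV₂ W P m = ∑ j ∈ Finset.Ico 1 m, ‖stepDiff H T m j‖ ^ 2 := by
  simp only [meanV₂, V₂]
  rw [integral_finsetSum _ fun j _ => (memLp_secondDiff hW m j).integrable_sq]
  exact Finset.sum_congr rfl fun j _ => integral_secondDiff_sq hW m j

theorem meanV₂_eq (hT : 0 < T) (hW : IsIsonormal W P) {m : ℕ} (hm : 0 < m) :
    meanV₂ W P m = ((m : ℝ) - 1) * (scale H T m * cH H) := by
  rw [meanV₂_eq_sum hW]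
  have : ∀ j ∈ Finset.Ico 1 m, ‖stepDiff H T m j‖ ^ 2 = scale H T m * cH H := fun j hj => by
    rw [← real_inner_self_eq_norm_sq, inner_stepDiff hT hj hj, sub_self, rhoHat_zero H.2.1]
  rw [Finset.sum_congr rfl this, Finset.sum_const, Nat.card_Ico, nsmul_eq_mul, Nat.cast_sub hm]
  simp

theorem V₂_sub_meanV₂_ae_eq (hW : IsIsonormal W P) (m : ℕ) :
    (fun ω => V₂ W m ω - meanV₂ W P m) =ᵐ[P] hW.I₂ (gridFamily H T m).diag := by
  have h1 := hW.I₂_sum_ae (Finset.Ico 1 m) (fun _ => 1) (stepDiff H T m)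
  simp only [one_smul, one_mul] at h1
  have h2 : ∀ᵐ ω ∂P, ∀ j ∈ Finset.Ico 1 m, secondDiff W m j ω = W (stepDiff H T m j) ω :=
    (Finset.eventually_all _).2 fun j _ => secondDiff_ae_eq hW m j
  filter_upwards [h1, h2] with ω g1 g2
  refine Eq.trans ?_ g1.symm
  rw [V₂, meanV₂_eq_sum hW, ← Finset.sum_sub_distrib]
  exact Finset.sum_congr rfl fun j hj => by rw [g2 j hj]

/-- The normalising weight `√n / E[V_m]`. -/
noncomputable def weight (W : CMSpace H T → Ω → ℝ) (P : Measure Ω) (n m : ℕ) : ℝ :=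
  √(n : ℝ) / meanV₂ W P m

/-- The difference `f_n^{[1]} - f_n^{[2]}` of the kernels. -/
noncomputable def kernDiff (W : CMSpace H T → Ω → ℝ) (P : Measure Ω) (n : ℕ) :
    CMSpace H T ⊗[ℝ] CMSpace H T :=
  weight W P n n • (gridFamily H T n).diag - weight W P n (2 * n) • (gridFamily H T (2 * n)).diag

/-- The `n - 1` squares have equal means, so the expression is `n / ((n - 1) c)`. On the fine grid
it becomes `n / ((2n - 1) c)`, whence the extra factor one half there. -/
theorem tendsto_weight_coarse (hT : 0 < T) (hW : IsIsonormal W P) :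
    Tendsto (fun n : ℕ => √(n : ℝ) * weight W P n n * scale H T n) atTop (𝓝 (cH H)⁻¹) := by
  have hc := (cH_pos H.2.2).ne'
  have hl : Tendsto (fun n : ℕ => ((1 - 1 / (n : ℝ)) * cH H)⁻¹) atTop (𝓝 (cH H)⁻¹) := by
    have h1 : Tendsto (fun n : ℕ => (1 - 1 / (n : ℝ)) * cH H) atTop (𝓝 ((1 - 0) * cH H)) :=
      (tendsto_one_div_atTop_nhds_zero_nat.const_sub 1).mul_const _
    simpa using h1.inv₀ (by simpa using hc)
  refine hl.congr' ?_
  filter_upwards [eventually_gt_atTop 1] with n hn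
  have hn0 : (n : ℝ) ≠ 0 := by positivity
  have hn1 : (n : ℝ) - 1 ≠ 0 := by
    have : (1 : ℝ) < n := by exact_mod_cast hn
    linarith
  have hs := (scale_pos (H := H) hT (by omega : 0 < n)).ne'
  rw [weight, meanV₂_eq hT hW (by omega)]
  have h2 : √(n : ℝ) * √(n : ℝ) = n := Real.mul_self_sqrt (Nat.cast_nonneg n)
  field_simp
  rw [sq, h2]

theorem tendsto_weight_fine (hT : 0 < T) (hW : IsIsonormal W P) :
    Tendsto (fun n : ℕ => √(n : ℝ) * weight W P n (2 * n) * scale H T (2 * n)) atTop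
      (𝓝 (2 * cH H)⁻¹) := by
  have hc := (cH_pos H.2.2).ne'
  have hl : Tendsto (fun n : ℕ => ((2 - 1 / (n : ℝ)) * cH H)⁻¹) atTop (𝓝 (2 * cH H)⁻¹) := by
    have h1 : Tendsto (fun n : ℕ => (2 - 1 / (n : ℝ)) * cH H) atTop (𝓝 ((2 - 0) * cH H)) :=
      (tendsto_one_div_atTop_nhds_zero_nat.const_sub 2).mul_const _
    simpa using h1.inv₀ (by simpa using hc)
  refine hl.congr' ?_
  filter_upwards [eventually_gt_atTop 1] with n hn
  have hn0 : (n : ℝ) ≠ 0 := by positivity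
  have hn1 : 2 * (n : ℝ) - 1 ≠ 0 := by
    have : (1 : ℝ) < n := by exact_mod_cast hn
    linarith
  have hs := (scale_pos (H := H) hT (by omega : 0 < 2 * n)).ne'
  rw [weight, meanV₂_eq hT hW (by omega)]
  push_cast
  have h2 : √(n : ℝ) * √(n : ℝ) = n := Real.mul_self_sqrt (Nat.cast_nonneg n)
  field_simp
  rw [sq, h2]

theorem sum_abs_inner_gridFamily_le (hT : 0 < T) {m : ℕ} (i : ℕ) (hi : i ∈ (gridFamily H T m).idx) :
    ∑ j ∈ (gridFamily H T m).idx, |⟪(gridFamily H T m).vec i, (gridFamily H T m).vec j⟫_ℝ| ≤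
      scale H T m * ∑' j, |rhoHat H j| := by
  simp only [gridFamily] at hi ⊢
  have hm : 0 < m := by rw [Finset.mem_Ico] at hi; omega
  have e : ∀ j ∈ Finset.Ico 1 m, |⟪stepDiff H T m i, stepDiff H T m j⟫_ℝ| =
      scale H T m * |rhoHat H ((i : ℤ) - j)| := fun j hj => by
    rw [inner_stepDiff hT hi hj, abs_mul, abs_of_pos (scale_pos hT hm)]
  rw [Finset.sum_congr rfl e, ← Finset.mul_sum]
  refine mul_le_mul_of_nonneg_left ?_ (scale_pos hT hm).le
  have hinj : Function.Injective fun j : ℕ => (i : ℤ) - j := fun a b h => by grind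
  rw [← Finset.sum_image (f := fun k : ℤ => |rhoHat H k|) fun a _ b _ h => hinj h]
  exact (summable_rhoHat H.2.2).abs.sum_le_tsum _ fun _ _ => abs_nonneg _

theorem sum_inner_gridFamily_sq_le (hT : 0 < T) {m : ℕ} (hm : 0 < m) {e : CMSpace H T}
    (he : ‖e‖ = 1) : ∑ i ∈ (gridFamily H T m).idx, ⟪(gridFamily H T m).vec i, e⟫_ℝ ^ 2 ≤
      scale H T m * ∑' j, |rhoHat H j| :=
  sum_inner_sq_le _ (sum_abs_inner_gridFamily_le hT)
    (mul_nonneg (scale_pos hT hm).le (tsum_nonneg fun _ => abs_nonneg _)) he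

end Limits

/-! ### Limits for the kernel difference and the joint law. -/

section Main

open Family

variable {H : Set.Ioo (0 : ℝ) 1} {T : ℝ} {Ω : Type*} {mΩ : MeasurableSpace Ω} {P : Measure Ω}
  {W : CMSpace H T → Ω → ℝ}

theorem tendsto_fine {X : ℕ → ℝ} {l : ℝ}
    (h : Tendsto (fun n : ℕ => (n : ℝ)⁻¹ * X n) atTop (𝓝 l)) :
    Tendsto (fun n : ℕ => (n : ℝ)⁻¹ * X (2 * n)) atTop (𝓝 (2 * l)) := by
  have h2 : Tendsto (fun n : ℕ => 2 * n) atTop atTop :=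
    tendsto_atTop_mono (fun n => by simp only [id]; omega) tendsto_id
  refine ((h.comp h2).const_mul 2).congr fun n => ?_
  simp only [Function.comp_apply]
  push_cast
  rw [mul_inv]
  ring

/-- Both series are limits of one cyclic sum, read from a fine base vertex and from a coarse one.
Hence `κ(1,1;2,2)` merges with the first part of `κ(1,2;1,2)` in `U33`. -/
theorem tsum_term11_22 (hT : 0 < T) : ∑' j, term11_22 H j = ∑' j, term12_12a H j := by
  refine tendsto_nhds_unique (tendsto_cyc4_FCCF (H := H) hT) ((tendsto_cyc4_CCFF hT).congr fun n => ?_)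
  rw [cyc4_rotate (gridFamily H T (2 * n)), cyc4_rotate (gridFamily H T n) (gridFamily H T n)]

/-- Weighted sums along cycles of length two. -/
theorem tendsto_quadratic (hT : 0 < T) (hW : IsIsonormal W P) (r : ℝ) :
    Tendsto (fun n => ⟪weight W P n n • (gridFamily H T n).diag
        - (r * weight W P n (2 * n)) • (gridFamily H T (2 * n)).diag,
      weight W P n n • (gridFamily H T n).diag
        - (r * weight W P n (2 * n)) • (gridFamily H T (2 * n)).diag⟫_ℝ) atTop
      (𝓝 ((1 + r ^ 2 / 2) / cH H ^ 2 * (∑' j, rhoHat H j ^ 2)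
        - r * 2 ^ (2 * (H : ℝ)) / cH H ^ 2 * ∑' j, term12 H j)) := by
  have hc := (cH_pos H.2.2).ne'
  set θ : ℝ := 2 ^ (2 * (H : ℝ)) with hθ
  have hp := tendsto_weight_coarse hT hW
  have hq := tendsto_weight_fine hT hW
  have l1 := tendsto_cyc2_CC (H := H) hT
  have l2 := tendsto_cyc2_CF (H := H) hT
  have l3 : Tendsto (fun n : ℕ => (n : ℝ)⁻¹ * (cyc2 (gridFamily H T (2 * n))
      (gridFamily H T (2 * n)) / scale H T (2 * n) ^ 2)) atTop
      (𝓝 (2 * ∑' j, rhoHat H j ^ 2)) :=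
    tendsto_fine (X := fun n => cyc2 (gridFamily H T n) (gridFamily H T n) / scale H T n ^ 2)
      (by simpa only [mul_div_assoc] using l1)
  -- The factor `θ` turns the fine scale into the coarse one, so that in mixed terms the weights
  -- cancel the normalisation of the cyclic sum. The third and fourth order limits use it likewise.
  have key := (((hp.pow 2).mul l1).sub (((hp.mul (hq.const_mul θ)).mul l2).const_mul (2 * r))).add
    (((hq.pow 2).mul l3).const_mul (r ^ 2))
  have hlim : ((cH H)⁻¹ ^ 2 * ∑' j, rhoHat H j ^ 2) - 2 * r * ((cH H)⁻¹ * (θ * (2 * cH H)⁻¹) *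
      ∑' j, term12 H j) + r ^ 2 * ((2 * cH H)⁻¹ ^ 2 * (2 * ∑' j, rhoHat H j ^ 2)) =
      (1 + r ^ 2 / 2) / cH H ^ 2 * (∑' j, rhoHat H j ^ 2)
        - r * θ / cH H ^ 2 * ∑' j, term12 H j := by
    field_simp
    ring
  rw [hlim] at key
  refine key.congr' ?_
  filter_upwards [eventually_gt_atTop 0] with n hn
  rw [inner_diag_sub_diag]
  have hs : √(n : ℝ) ≠ 0 := (Real.sqrt_pos.2 (Nat.cast_pos.2 hn)).ne'
  have hn2 : (n : ℝ) = √(n : ℝ) ^ 2 := (Real.sq_sqrt (Nat.cast_nonneg n)).symm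
  have ha := (scale_pos (H := H) hT (by omega : 0 < 2 * n)).ne'
  have hθ0 : θ ≠ 0 := by positivity
  rw [scale_eq hT n, ← hθ]
  generalize √(n : ℝ) = s at *
  rw [hn2]
  field_simp

theorem tendsto_kernDiff_two (hT : 0 < T) (hW : IsIsonormal W P) :
    Tendsto (fun n => ⟪kernDiff W P n, kernDiff W P n⟫_ℝ) atTop
      (𝓝 (3 / 2 / cH H ^ 2 * (∑' j, rhoHat H j ^ 2)
        - 2 ^ (2 * (H : ℝ)) / cH H ^ 2 * ∑' j, term12 H j)) := by
  have h := tendsto_quadratic hT hW 1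
  simp only [one_mul] at h
  rw [show (3 / 2 : ℝ) = 1 + 1 ^ 2 / 2 by norm_num]
  exact h

theorem tendsto_kernDiff_three (hT : 0 < T) (hW : IsIsonormal W P) :
    Tendsto (fun n : ℕ => √(n : ℝ) * ⟪kernDiff W P n, contrₗ (kernDiff W P n) (kernDiff W P n)⟫_ℝ)
      atTop (𝓝 (kappa1_11 H - 3 * kappa2_11 H + 3 * kappa1_22 H - kappa2_22 H)) := by
  have hc := (cH_pos H.2.2).ne'
  set θ : ℝ := 2 ^ (2 * (H : ℝ)) with hθ
  have hp := tendsto_weight_coarse hT hW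
  have hq := tendsto_weight_fine hT hW
  have l1 := tendsto_cyc3_CCC (H := H) hT
  have l2 := tendsto_cyc3_CCF (H := H) hT
  have l3 := tendsto_cyc3_CFF (H := H) hT
  have l4 : Tendsto (fun n : ℕ => (n : ℝ)⁻¹ * (cyc3 (gridFamily H T (2 * n))
      (gridFamily H T (2 * n)) (gridFamily H T (2 * n)) / scale H T (2 * n) ^ 3)) atTop
      (𝓝 (2 * ∑' j, term1_11 H j)) :=
    tendsto_fine (X := fun n => cyc3 (gridFamily H T n) (gridFamily H T n) (gridFamily H T n)
      / scale H T n ^ 3) (by simpa only [mul_div_assoc] using l1)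
  have key := ((((hp.pow 3).mul l1).sub
    ((((hp.pow 2).mul (hq.const_mul θ)).mul l2).const_mul 3)).add
    (((hp.mul ((hq.pow 2).const_mul θ)).mul l3).const_mul 3)).sub ((hq.pow 3).mul l4)
  have hlim : (cH H)⁻¹ ^ 3 * (∑' j, term1_11 H j)
      - 3 * ((cH H)⁻¹ ^ 2 * (θ * (2 * cH H)⁻¹) * ∑' j, term2_11 H j)
      + 3 * ((cH H)⁻¹ * (θ * (2 * cH H)⁻¹ ^ 2) * ∑' j, term1_22 H j)
      - (2 * cH H)⁻¹ ^ 3 * (2 * ∑' j, term1_11 H j) =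
      kappa1_11 H - 3 * kappa2_11 H + 3 * kappa1_22 H - kappa2_22 H := by
    simp only [kappa2_22, kappa1_11, kappa2_11, kappa1_22]
    rw [Real.rpow_sub two_pos, Real.rpow_sub two_pos, ← hθ,
      show (2 : ℝ) ^ (2 : ℝ) = 4 by norm_num, Real.rpow_one]
    field_simp
    ring
  rw [hlim] at key
  refine key.congr' ?_
  filter_upwards [eventually_gt_atTop 0] with n hn
  rw [kernDiff, inner_contrₗ_diag_sub_diag]
  have hs : √(n : ℝ) ≠ 0 := (Real.sqrt_pos.2 (Nat.cast_pos.2 hn)).ne'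
  have hn2 : (n : ℝ) = √(n : ℝ) ^ 2 := (Real.sq_sqrt (Nat.cast_nonneg n)).symm
  have ha := (scale_pos (H := H) hT (by omega : 0 < 2 * n)).ne'
  have hθ0 : θ ≠ 0 := by positivity
  rw [scale_eq hT n, ← hθ]
  generalize √(n : ℝ) = s at *
  rw [hn2]
  field_simp

theorem tendsto_kernDiff_four (hT : 0 < T) (hW : IsIsonormal W P) :
    Tendsto (fun n : ℕ => (n : ℝ) * ⟪contrₗ (kernDiff W P n) (kernDiff W P n),
      contrₗ (kernDiff W P n) (kernDiff W P n)⟫_ℝ) atTop (𝓝 (U33 H / 8)) := by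
  have hc := (cH_pos H.2.2).ne'
  set θ : ℝ := 2 ^ (2 * (H : ℝ)) with hθ
  have hp := tendsto_weight_coarse hT hW
  have hq := tendsto_weight_fine hT hW
  have l1 := tendsto_cyc4_CCCC (H := H) hT
  have l2 := tendsto_cyc4_CCFC (H := H) hT
  have l3 := tendsto_cyc4_CCFF (H := H) hT
  have l4 := tendsto_cyc4_FCFC (H := H) hT
  have l5 := tendsto_cyc4_CFFF (H := H) hT
  have l6 : Tendsto (fun n : ℕ => (n : ℝ)⁻¹ * (cyc4 (gridFamily H T (2 * n))
      (gridFamily H T (2 * n)) (gridFamily H T (2 * n)) (gridFamily H T (2 * n))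
      / scale H T (2 * n) ^ 4)) atTop (𝓝 (2 * ∑' j, term11_11 H j)) :=
    tendsto_fine (X := fun n => cyc4 (gridFamily H T n) (gridFamily H T n) (gridFamily H T n)
      (gridFamily H T n) / scale H T n ^ 4) (by simpa only [mul_div_assoc] using l1)
  have key := (((((hp.pow 4).mul l1).sub
    ((((hp.pow 3).mul (hq.const_mul θ)).mul l2).const_mul 4)).add
    (((hp.pow 2).mul (hq.pow 2)).mul ((l3.const_mul (4 * θ)).add (l4.const_mul (2 * θ ^ 2))))).sub
    (((hp.mul ((hq.pow 3).const_mul θ)).mul l5).const_mul 4)).add ((hq.pow 4).mul l6)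
  have hlim : (cH H)⁻¹ ^ 4 * (∑' j, term11_11 H j)
      - 4 * ((cH H)⁻¹ ^ 3 * (θ * (2 * cH H)⁻¹) * ∑' j, term11_12 H j)
      + (cH H)⁻¹ ^ 2 * (2 * cH H)⁻¹ ^ 2 * (4 * θ * (∑' j, term12_12a H j)
        + 2 * θ ^ 2 * (∑' j, term12_12b H j + ∑' j, term12_12c H j))
      - 4 * ((cH H)⁻¹ * (θ * (2 * cH H)⁻¹ ^ 3) * ∑' j, term12_22 H j)
      + (2 * cH H)⁻¹ ^ 4 * (2 * ∑' j, term11_11 H j) = U33 H / 8 := by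
    have h8 : (2 : ℝ) ^ (3 : ℝ) = 8 := by norm_num
    simp only [U33, kappa22_22, kappa12_12, kappa11_11, kappa12_22, kappa11_22, kappa11_12]
    rw [tsum_term11_22 hT, Real.rpow_sub two_pos, Real.rpow_sub two_pos, Real.rpow_sub two_pos,
      Real.rpow_sub two_pos, show 4 * (H : ℝ) = 2 * H + 2 * H by ring, Real.rpow_add two_pos, ← hθ,
      show (2 : ℝ) ^ (2 : ℝ) = 4 by norm_num, h8, Real.rpow_one]
    field_simp
    ring
  rw [hlim] at key
  refine key.congr' ?_
  filter_upwards [eventually_gt_atTop 0] with n hn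
  rw [kernDiff, inner_contrₗ_contrₗ_diag_sub_diag]
  have hs : √(n : ℝ) ≠ 0 := (Real.sqrt_pos.2 (Nat.cast_pos.2 hn)).ne'
  have hn2 : (n : ℝ) = √(n : ℝ) ^ 2 := (Real.sq_sqrt (Nat.cast_nonneg n)).symm
  have ha := (scale_pos (H := H) hT (by omega : 0 < 2 * n)).ne'
  have hθ0 : θ ≠ 0 := by positivity
  rw [scale_eq hT n, ← hθ]
  generalize √(n : ℝ) = s at *
  rw [hn2]
  field_simp

/-- Both grids share one index set, so that the spectral theorem is applied to a single family with
weights of both signs. -/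
theorem kernDiff_eq_sum (n : ℕ) : kernDiff W P n =
    ∑ k ∈ (Finset.Ico 1 n).disjSum (Finset.Ico 1 (2 * n)),
      Sum.elim (fun _ => weight W P n n) (fun _ => -weight W P n (2 * n)) k •
        (Sum.elim (stepDiff H T n) (stepDiff H T (2 * n)) k ⊗ₜ[ℝ]
          Sum.elim (stepDiff H T n) (stepDiff H T (2 * n)) k) := by
  rw [Finset.sum_disjSum, kernDiff, diag, diag, Finset.smul_sum, Finset.smul_sum, sub_eq_add_neg,
    ← Finset.sum_neg_distrib]
  simp [gridFamily]

theorem kern_one (n : ℕ) : kern W P 1 n = weight W P n n • (gridFamily H T n).diag := by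
  rw [kern, one_mul]; rfl

theorem kern_two (n : ℕ) :
    kern W P 2 n = weight W P n (2 * n) • (gridFamily H T (2 * n)).diag := rfl

theorem kernDiff_eq (n : ℕ) : kernDiff W P n = kern W P 1 n - kern W P 2 n := by
  rw [kern_one, kern_two]; rfl

/-- Swapping tensor factors exchanges the two mixed contractions, so `⊙₁` supplies exactly the cross
terms of a square. -/
theorem Gtilde_eq (hW : IsIsonormal W P) (n : ℕ) :
    Gtilde hW n = hW.I₂ ((2 : ℝ) • contrₗ (kernDiff W P n) (kernDiff W P n)) := by
  have hsym : symContr₁ (kern W P 2 n) (kern W P 1 n) =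
      (1 / 2 : ℝ) • (contrₗ (kern W P 2 n) (kern W P 1 n)
        + contrₗ (kern W P 1 n) (kern W P 2 n)) := by
    rw [symContr₁, contr₁_eq, kern_one, kern_two]
    simp only [map_smul, LinearMap.smul_apply, diag, comm_contrₗ_sum_sum]
    module
  rw [Gtilde, hsym, contr₁_eq, contr₁_eq, kernDiff_eq]
  simp only [map_sub, map_smul, map_add, LinearMap.sub_apply]
  module

theorem aemeasurable_M (hW : IsIsonormal W P) (n : ℕ) : AEMeasurable (M W P n) P := by
  have hV : ∀ m, AEMeasurable (V₂ W m) P := fun m => by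
    have h : ∀ j, AEMeasurable (secondDiff W m j) P := fun j =>
      (memLp_secondDiff hW m j).aestronglyMeasurable.aemeasurable
    exact Finset.aemeasurable_fun_sum _ fun j _ => (h j).pow_const 2
  have h1 := hV n
  have h2 := hV (2 * n)
  unfold M
  fun_prop

theorem M_ae_eq (hT : 0 < T) (hW : IsIsonormal W P) {n : ℕ} (hn : 1 < n) :
    M W P n =ᵐ[P] hW.I₂ (kernDiff W P n) := by
  -- For `m ≤ 1` the sum `V_m` is empty and has mean zero, so the division is meaningful only from
  -- `m = 2` on.
  have hne : ∀ m : ℕ, 1 < m → meanV₂ W P m ≠ 0 := fun m hm => by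
    rw [meanV₂_eq hT hW (by omega)]
    have h1 : (1 : ℝ) < m := by exact_mod_cast hm
    exact mul_ne_zero (by linarith)
      (mul_pos (scale_pos hT (by omega)) (cH_pos H.2.2)).ne'
  have h1 := hne n hn
  have h2 := hne (2 * n) (by omega)
  rw [kernDiff, map_sub, map_smul, map_smul]
  filter_upwards [V₂_sub_meanV₂_ae_eq hW n, V₂_sub_meanV₂_ae_eq hW (2 * n),
    AEEqFun.coeFn_sub (weight W P n n • hW.I₂ (gridFamily H T n).diag)
      (weight W P n (2 * n) • hW.I₂ (gridFamily H T (2 * n)).diag),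
    AEEqFun.coeFn_smul (weight W P n n) (hW.I₂ (gridFamily H T n).diag),
    AEEqFun.coeFn_smul (weight W P n (2 * n)) (hW.I₂ (gridFamily H T (2 * n)).diag)]
    with ω g1 g2 g3 g4 g5
  rw [g3, Pi.sub_apply, g4, g5, Pi.smul_apply, Pi.smul_apply, ← g1, ← g2, M, weight, weight,
    smul_eq_mul, smul_eq_mul]
  field_simp
  ring

theorem sqrt_mul_Gtilde_ae_eq (hW : IsIsonormal W P) (n : ℕ) :
    (fun ω => √(n : ℝ) * Gtilde hW n ω) =ᵐ[P]
      hW.I₂ ((2 * √(n : ℝ)) • contrₗ (kernDiff W P n) (kernDiff W P n)) := by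
  have e : hW.I₂ ((2 * √(n : ℝ)) • contrₗ (kernDiff W P n) (kernDiff W P n)) =
      √(n : ℝ) • Gtilde hW n := by
    rw [Gtilde_eq, ← hW.I₂.map_smul √(n : ℝ), smul_smul, mul_comm]
  rw [e]
  filter_upwards [AEEqFun.coeFn_smul (√(n : ℝ)) (Gtilde hW n)] with ω h
  rw [h, Pi.smul_apply, smul_eq_mul]

theorem exists_bound_kernDiff (hT : 0 < T) (hW : IsIsonormal W P) :
    ∃ K, ∀ᶠ n : ℕ in atTop, ∀ e : CMSpace H T, ‖e‖ = 1 →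
      √(n : ℝ) * |∑ k ∈ (Finset.Ico 1 n).disjSum (Finset.Ico 1 (2 * n)),
        Sum.elim (fun _ => weight W P n n) (fun _ => -weight W P n (2 * n)) k *
          ⟪Sum.elim (stepDiff H T n) (stepDiff H T (2 * n)) k, e⟫_ℝ ^ 2| ≤ K := by
  set L := ∑' j, |rhoHat H j| with hL
  have hL0 : 0 ≤ L := tsum_nonneg fun _ => abs_nonneg _
  -- Each `√n · weight · scale` converges, hence is eventually below its limit plus one.
  refine ⟨((cH H)⁻¹ + 1) * L + ((2 * cH H)⁻¹ + 1) * L, ?_⟩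
  filter_upwards [(tendsto_weight_coarse hT hW).eventually (gt_mem_nhds (lt_add_one _)),
    (tendsto_weight_fine hT hW).eventually (gt_mem_nhds (lt_add_one _)),
    eventually_gt_atTop 1] with n h1 h2 hn e he
  have b1 := sum_inner_gridFamily_sq_le (H := H) hT (by omega : 0 < n) he
  have b2 := sum_inner_gridFamily_sq_le (H := H) hT (by omega : 0 < 2 * n) he
  simp only [gridFamily] at b1 b2
  have hw : ∀ m, 0 ≤ weight W P n m := fun m =>
    div_nonneg (Real.sqrt_nonneg _)
      (integral_nonneg fun ω => Finset.sum_nonneg fun j _ => sq_nonneg _)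
  rw [Finset.sum_disjSum]
  simp only [Sum.elim_inl, Sum.elim_inr, ← Finset.mul_sum]
  set S₁ := ∑ i ∈ Finset.Ico 1 n, ⟪stepDiff H T n i, e⟫_ℝ ^ 2
  set S₂ := ∑ i ∈ Finset.Ico 1 (2 * n), ⟪stepDiff H T (2 * n) i, e⟫_ℝ ^ 2
  have p1 : 0 ≤ S₁ := Finset.sum_nonneg fun _ _ => sq_nonneg _
  have p2 : 0 ≤ S₂ := Finset.sum_nonneg fun _ _ => sq_nonneg _
  have hs := Real.sqrt_nonneg (n : ℝ)
  calc √(n : ℝ) * |weight W P n n * S₁ + -weight W P n (2 * n) * S₂|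
      ≤ √(n : ℝ) * (weight W P n n * S₁ + weight W P n (2 * n) * S₂) := by
        refine mul_le_mul_of_nonneg_left ((abs_add_le _ _).trans (le_of_eq ?_)) hs
        rw [abs_mul, abs_mul, abs_neg, abs_of_nonneg (hw _), abs_of_nonneg (hw _),
          abs_of_nonneg p1, abs_of_nonneg p2]
    _ ≤ √(n : ℝ) * (weight W P n n * (scale H T n * L)
          + weight W P n (2 * n) * (scale H T (2 * n) * L)) := by
        gcongr
        · exact hw _
        · exact hw _
    _ = √(n : ℝ) * weight W P n n * scale H T n * L
          + √(n : ℝ) * weight W P n (2 * n) * scale H T (2 * n) * L := by ring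
    _ ≤ _ := by gcongr

theorem matT_zero_zero (H : ℝ) : matT H 0 0 = Sigma22 H - 2 * Sigma12 H + Sigma11 H := by
  simp [matT, matU]
  ring

/-- Nonnegativity of `‖f_n^{[1]} - r f_n^{[2]}‖²` in the limit, at `r = √2`. This is the best `r`,
because `f_n^{[2]}` has half the limiting squared norm of `f_n^{[1]}`. -/
theorem sqrt_two_mul_Sigma12_le (hT : 0 < T) (hW : IsIsonormal W P) :
    √2 * Sigma12 H ≤ Sigma11 H := by
  have h0 := ge_of_tendsto' (b := 0) (tendsto_quadratic hT hW √2) fun n =>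
    real_inner_self_nonneg (F := CMSpace H T ⊗[ℝ] CMSpace H T)
  rw [Sigma11_eq H.2.1 H.2.2, Sigma12]
  rw [Real.sq_sqrt zero_le_two] at h0
  have e : (1 + 2 / 2) / cH H ^ 2 * (∑' j, rhoHat H j ^ 2)
      - √2 * 2 ^ (2 * (H : ℝ)) / cH H ^ 2 * ∑' j, term12 H j =
      2 / cH H ^ 2 * (∑' j, rhoHat H j ^ 2)
      - √2 * (2 ^ (2 * (H : ℝ)) / cH H ^ 2 * ∑' j, term12 H j) := by ring
  rw [e] at h0
  linarith

theorem Sigma11_pos {H : ℝ} (h1 : H < 1) : 0 < Sigma11 H := by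
  have h : 0 ≤ ∑' k, term11 H k := tsum_nonneg fun k => sq_nonneg _
  have := cH_pos h1
  rw [Sigma11]
  positivity

end Main

end FracBM

theorem corollary2108140225 (H : Set.Ioo (0 : ℝ) 1) (T : ℝ) (hT : 0 < T)
    {Ω : Type*} [MeasurableSpace Ω] (P : Measure Ω) [IsProbabilityMeasure P]
    (W : FracBM.CMSpace H T → Ω → ℝ) (hW : FracBM.IsIsonormal W P) :
    FracBM.SeriesConverge H ∧
    (FracBM.matT H).PosSemidef ∧
    TendstoInDistribution
      (fun (n : ℕ) (ω : Ω) =>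
        (!₂[FracBM.M W P n ω, √(n : ℝ) * FracBM.Gtilde hW n ω] : EuclideanSpace ℝ (Fin 2)))
      atTop id (fun _ => P) (multivariateGaussian 0 (FracBM.matT H)) ∧
    FracBM.Ginf H = FracBM.matT H 0 0 ∧
    FracBM.matT H 0 0 = FracBM.Sigma22 H - 2 * FracBM.Sigma12 H + FracBM.Sigma11 H ∧
    FracBM.matT H 0 0 = 3 / 2 * FracBM.Sigma11 H - 2 * FracBM.Sigma12 H ∧
    (3 / 2 - √2) * FracBM.Sigma11 H ≤ FracBM.matT H 0 0 ∧
    0 < (3 / 2 - √2) * FracBM.Sigma11 H := by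
  have h00 := FracBM.matT_zero_zero H
  have h00' : FracBM.matT H 0 0 = 3 / 2 * FracBM.Sigma11 H - 2 * FracBM.Sigma12 H := by
    rw [h00, FracBM.Sigma22]; ring
  obtain ⟨K, hK⟩ := FracBM.exists_bound_kernDiff hT hW
  have hmat : FracBM.matT H = !![2 * (3 / 2 / FracBM.cH H ^ 2 * (∑' j, FracBM.rhoHat H j ^ 2)
        - 2 ^ (2 * (H : ℝ)) / FracBM.cH H ^ 2 * ∑' j, FracBM.term12 H j),
      4 * (FracBM.kappa1_11 H - 3 * FracBM.kappa2_11 H + 3 * FracBM.kappa1_22 H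
        - FracBM.kappa2_22 H);
      4 * (FracBM.kappa1_11 H - 3 * FracBM.kappa2_11 H + 3 * FracBM.kappa1_22 H
        - FracBM.kappa2_22 H), 8 * (FracBM.U33 H / 8)] := by
    -- The coincidences `κ(1;1,2) = κ(2;1,1)` and `κ(2;1,2) = κ(1;2,2)` produce the binomial pattern
    -- 1, -3, 3, -1 of a cube.
    have e01 : FracBM.U13 H - FracBM.U23 H = 4 * (FracBM.kappa1_11 H - 3 * FracBM.kappa2_11 H
        + 3 * FracBM.kappa1_22 H - FracBM.kappa2_22 H) := by
      rw [FracBM.U13, FracBM.U23, FracBM.kappa1_12, FracBM.kappa2_12]; ring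
    ext i j
    fin_cases i <;> fin_cases j
    · refine h00'.trans ?_
      rw [FracBM.Sigma11_eq H.2.1 H.2.2, FracBM.Sigma12]
      simp only [Fin.zero_eta, Matrix.of_apply, Matrix.cons_val', Matrix.cons_val_zero]
      ring
    · simpa [FracBM.matT, FracBM.matU] using e01
    · simpa [FracBM.matT, FracBM.matU] using e01
    · simp [FracBM.matT, FracBM.matU]
      ring
  obtain ⟨hpos, hdist⟩ := hW.tendstoInDistribution
    (fun n => (Finset.Ico 1 n).disjSum (Finset.Ico 1 (2 * n))) _ _ (FracBM.kernDiff W P)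
    FracBM.kernDiff_eq_sum (FracBM.tendsto_kernDiff_two hT hW)
    (FracBM.tendsto_kernDiff_three hT hW) (FracBM.tendsto_kernDiff_four hT hW) hK
    (FracBM.aemeasurable_M hW)
    (fun n => (FracBM.Gtilde hW n).aestronglyMeasurable.aemeasurable.const_mul _)
    ((eventually_gt_atTop 1).mono fun n hn => FracBM.M_ae_eq hT hW hn)
    (Eventually.of_forall fun n => FracBM.sqrt_mul_Gtilde_ae_eq hW n) hmat
  have h2 := FracBM.sqrt_two_mul_Sigma12_le hT hW
  have hS := FracBM.Sigma11_pos H.2.2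
  have hsq : √2 ^ 2 = (2 : ℝ) := Real.sq_sqrt zero_le_two
  have hs0 := Real.sqrt_nonneg 2
  refine ⟨FracBM.seriesConverge H.2.2, hpos, hdist, ?_, h00, h00', ?_, ?_⟩
  · rw [h00]; rfl
  · rw [h00']
    -- Multiplying `√2 Σ₁₂ ≤ Σ₁₁` by `√2` gives `2 Σ₁₂ ≤ √2 Σ₁₁`.
    have h3 := mul_le_mul_of_nonneg_left h2 hs0
    rw [← mul_assoc, ← sq, hsq] at h3
    linarith
  · refine mul_pos ?_ hS
    nlinarith
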